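/- Let $\mathfrak R$ be an associative unital topological ring that is complete and separated and has a countable base of neighborhoods of zero formed by open right ideals. For a set $X$, let $\mathfrak R[[X]]$ be the set of formal sums $\sum_{x\in X} r_x x$ with $r_x\in\mathfrak R$ such that every neighborhood of zero contains $r_x$ for all but finitely many $x$. A left $\mathfrak R$-contramodule is an algebra over the monad $X\mapsto\mathfrak R[[X]]$ on the category of sets (whose unit is $x\mapsto 1\cdot x$ and whose multiplication is opening of parentheses); left $\mathfrak R$-contramodules form an abelian category $\mathfrak R\text{-}\mathrm{Contra}$, in which $\mathfrak R=\mathfrak R[[\{*\}]]$ is the free contramodule with one generator. Let $\mathcal S$ be a set of left $\mathfrak R$-contramodules and let $(\mathcal F,\mathcal C)$ be the cotorsion theory generated by $\mathcal S$; that is, $\mathcal C$ is the class of all contramodules $C$ with $\operatorname{Ext}^1(S,C)=0$ for all $S\in\mathcal S$, and $\mathcal F$ is the class of all contramodules $F$ with $\operatorname{Ext}^1(F,C)=0$ for all $C\in\mathcal C$, where $\operatorname{Ext}^1$ is taken in $\mathfrak R\text{-}\mathrm{Contra}$. Then: 1. Every left $\mathfrak R$-contramodule $P$ has a special $\mathcal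 F$-precover, i.e., there is an epimorphism $F\to P$ with $F\in\mathcal F$ and kernel in $\mathcal C$. 2. Every left $\mathfrak R$-contramodule $P$ that can be embedded as a subcontramodule into a contramodule from $\mathcal C$ has a special $\mathcal C$-preenvelope, i.e., there is a monomorphism $P\to C$ with $C\in\mathcal C$ and cokernel in $\mathcal F$. 3. A left $\mathfrak R$-contramodule belongs to $\mathcal F$ if and only if it is a direct summand of a contramodule from $\operatorname{Filt}(\mathcal S\cup\{\mathfrak R\})$. Here, for a set $\mathcal S'$ of contramodules, $\operatorname{Filt}(\mathcal S')$ is the class of all contramodules $F$ for which there are an ordinal $\alpha$ and a chain of contramodules and morphisms $(F_i\to F_j)_{i<j\le\alpha}$ such that $F_0=0$, $F_\alpha=F$, $F_j=\varinjlim_{i<j}F_i$ for every limit ordinal $j\le\alpha$, and $F_i\to F_{i+1}$ is a monomorphism with cokernel isomorphic to an object of $\mathcal S'$ for every $i<\alpha$. -/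

import Mathlib

open CategoryTheory CategoryTheory.Limits Filter Topology

universe u v w

noncomputable section

namespace Contramodule

set_option linter.unusedSectionVars false

section FormalCombinations

variable (R : Type u) [Ring R] [UniformSpace R] [IsUniformAddGroup R] [IsTopologicalRing R]

/-- The group `R[[X]]` of infinite formal linear combinations `∑ a x • x` of elements of a set `X`,
whose families of coefficients `a : X → R` converge to zero: every neighborhood of zero contains
`a x` for all but finitely many `x`. -/
def Formal (X : Type v) : AddSubgroup (X → R) where
  carrier := {a | Tendsto a cofinite (𝓝 0)}
  zero_mem' := tendsto_const_nhds
  add_mem' := fun {a b} ha hb => by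
    have h : Tendsto (fun x => a x + b x) cofinite (𝓝 (0 + 0)) := Tendsto.add ha hb
    rw [add_zero] at h
    exact h
  neg_mem' := fun {a} ha => by
    have h : Tendsto (fun x => -a x) cofinite (𝓝 (-0)) := Tendsto.neg ha
    rw [neg_zero] at h
    exact h

variable {R}

theorem Formal.ext {X : Type v} {a b : Formal R X} (h : ∀ x, a.1 x = b.1 x) : a = b :=
  Subtype.ext (funext h)

/-- The point measure `X → R[[X]]`, with coefficient `1` at the given element. -/
def single {X : Type v} (x : X) : Formal R X :=
  ⟨fun y => by classical exact if y = x then 1 else 0, by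
    refine tendsto_nhds_of_eventually_eq ?_
    have : ∀ᶠ y in cofinite, y ≠ x := by simp [eventually_cofinite]
    filter_upwards [this] with y hy
    simp [hy]⟩

theorem single_self {X : Type v} (x : X) : (single x : Formal R X).1 x = 1 := by
  simp [single]

theorem single_ne {X : Type v} {x y : X} (h : y ≠ x) : (single x : Formal R X).1 y = 0 := by
  simp [single, h]

variable [IsLinearTopology Rᵐᵒᵖ R]

/-- The right ideals that are open form a base of neighborhoods of zero. -/
theorem tendsto_zero_iff {X : Type v} {a : X → R} :
    Tendsto a cofinite (𝓝 0) ↔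
      ∀ I : Submodule Rᵐᵒᵖ R, IsOpen (I : Set R) → ∀ᶠ x in cofinite, a x ∈ I := by
  rw [(IsLinearTopology.hasBasis_open_submodule Rᵐᵒᵖ (M := R)).tendsto_right_iff]
  rfl

theorem mul_mem_right {I : Submodule Rᵐᵒᵖ R} {a : R} (h : a ∈ I) (b : R) : a * b ∈ I := by
  simpa using I.smul_mem (MulOpposite.op b) h

theorem isClosed_of_isOpen {I : Submodule Rᵐᵒᵖ R} (h : IsOpen (I : Set R)) :
    IsClosed (I : Set R) :=
  AddSubgroup.isClosed_of_isOpen I.toAddSubgroup h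

/-- For `r : R` and an open right ideal `I`, the right ideal `{b | r * b ∈ I}` is open. -/
theorem eventually_mul_mem {X : Type v} {a : X → R} (ha : Tendsto a cofinite (𝓝 0)) (r : R)
    {I : Submodule Rᵐᵒᵖ R} (h : IsOpen (I : Set R)) : ∀ᶠ x in cofinite, r * a x ∈ I := by
  have h1 : Tendsto (fun x => r * a x) cofinite (𝓝 (r * 0)) := Tendsto.const_mul r ha
  rw [mul_zero] at h1
  exact h1 (h.mem_nhds I.zero_mem)

variable (R) in
theorem nonarchimedean : NonarchimedeanAddGroup R where
  is_nonarchimedean := fun U hU => by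
    obtain ⟨I, hI, hIU⟩ := (IsLinearTopology.hasBasis_open_submodule Rᵐᵒᵖ (M := R)).mem_iff.1 hU
    exact ⟨⟨I.toAddSubgroup, hI⟩, hIU⟩

theorem tsum_mem_of_isOpen {X : Type v} {f : X → R} {I : Submodule Rᵐᵒᵖ R}
    (h : IsOpen (I : Set R)) (hf : ∀ x, f x ∈ I) : ∑' x, f x ∈ I :=
  tsum_mem (isClosed_of_isOpen h) hf

variable [CompleteSpace R]

theorem summable_of_tendsto {X : Type v} {f : X → R} (h : Tendsto f cofinite (𝓝 0)) :
    Summable f :=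
  haveI := nonarchimedean R
  NonarchimedeanAddGroup.summable_of_tendsto_cofinite_zero h

variable [T2Space R]

/-- Products along a family converging to zero, with a family converging to zero for each index,
converge to zero on the product of the index sets. -/
theorem tendsto_prod {X : Type v} {Y : Type w} (a : Formal R X) (k : X → Formal R Y) (l : Y → R) :
    Tendsto (fun p : X × Y => a.1 p.1 * (k p.1).1 p.2 * l p.2) cofinite (𝓝 0) := by
  rw [tendsto_zero_iff]
  intro I hI
  have h1 : {x | a.1 x ∉ I}.Finite := tendsto_zero_iff.1 a.2 I hI
  have h2 : ∀ x, {y | a.1 x * (k x).1 y ∉ I}.Finite :=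
    fun x => eventually_mul_mem (k x).2 (a.1 x) hI
  have h3 : (⋃ x ∈ {x | a.1 x ∉ I}, Prod.mk x '' {y | a.1 x * (k x).1 y ∉ I}).Finite :=
    h1.biUnion fun x _ => (h2 x).image _
  refine h3.subset ?_
  rintro ⟨x, y⟩ hxy
  have hxy' : a.1 x * (k x).1 y ∉ I := fun h => hxy (mul_mem_right h _)
  simp only [Set.mem_iUnion]
  exact ⟨x, fun h => hxy' (mul_mem_right h _), y, hxy', rfl⟩

theorem tendsto_mul {X : Type v} (a : Formal R X) (l : X → R) :
    Tendsto (fun x => a.1 x * l x) cofinite (𝓝 0) := by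
  rw [tendsto_zero_iff]
  intro I hI
  filter_upwards [tendsto_zero_iff.1 a.2 I hI] with x hx
  exact mul_mem_right hx _

theorem summable_mul {X : Type v} (a : Formal R X) (l : X → R) :
    Summable (fun x => a.1 x * l x) :=
  summable_of_tendsto (tendsto_mul a l)

/-- Substitution of formal combinations `k x` for the elements `x` in a formal combination `a`. -/
def bind {X : Type v} {Y : Type w} (a : Formal R X) (k : X → Formal R Y) : Formal R Y :=
  ⟨fun y => ∑' x, a.1 x * (k x).1 y, by
    refine tendsto_zero_iff.2 fun I hI => ?_
    have h1 : {x | a.1 x ∉ I}.Finite := tendsto_zero_iff.1 a.2 I hI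
    have h2 : ∀ x, {y | a.1 x * (k x).1 y ∉ I}.Finite :=
      fun x => eventually_mul_mem (k x).2 (a.1 x) hI
    refine (h1.biUnion fun x _ => h2 x).subset fun y hy => ?_
    by_contra hcon
    refine hy (tsum_mem_of_isOpen hI fun x => ?_)
    by_contra hx
    refine hcon ?_
    simp only [Set.mem_iUnion]
    exact ⟨x, fun h => hx (mul_mem_right h _), hx⟩⟩

theorem bind_apply {X : Type v} {Y : Type w} (a : Formal R X) (k : X → Formal R Y) (y : Y) :
    (bind a k).1 y = ∑' x, a.1 x * (k x).1 y := rfl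

/-- The direct image map `R[[f]] : R[[X]] → R[[Y]]`: the coefficient at `y` is the (convergent)
sum of the coefficients over the preimages of `y`. -/
def map {X : Type v} {Y : Type w} (f : X → Y) (a : Formal R X) : Formal R Y :=
  ⟨fun y => ∑' x : {x : X // f x = y}, a.1 x.1, by
    refine tendsto_zero_iff.2 fun I hI => ?_
    have h1 : {x | a.1 x ∉ I}.Finite := tendsto_zero_iff.1 a.2 I hI
    refine (h1.image f).subset fun y hy => ?_
    by_contra hcon
    refine hy (tsum_mem_of_isOpen hI fun x => ?_)
    by_contra hx
    exact hcon ⟨x.1, hx, x.2⟩⟩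

/-- The "opening of parentheses" map `R[[R[[X]]]] → R[[X]]`. -/
def join {X : Type v} (t : Formal R (Formal R X)) : Formal R X :=
  ⟨fun x => ∑' s : Formal R X, t.1 s * s.1 x, (bind t id).2⟩

theorem join_eq_bind {X : Type v} (t : Formal R (Formal R X)) : join t = bind t id := rfl

theorem map_eq_bind {X : Type v} {Y : Type w} (f : X → Y) (a : Formal R X) :
    map f a = bind a (fun x => single (f x)) := by
  classical
  refine Formal.ext fun y => ?_
  change ∑' x : ({x : X | f x = y} : Set X), a.1 x.1 = ∑' x, a.1 x * (single (f x)).1 y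
  rw [tsum_subtype {x : X | f x = y} a.1]
  refine tsum_congr fun x => ?_
  by_cases h : f x = y
  · subst h
    simp [single_self]
  · simp [h, single_ne (R := R) (Ne.symm h)]

theorem bind_single_left {X : Type v} {Y : Type w} (x : X) (k : X → Formal R Y) :
    bind (single x) k = k x := by
  refine Formal.ext fun y => ?_
  rw [bind_apply, tsum_eq_single x]
  · rw [single_self, one_mul]
  · intro x' hx'
    rw [single_ne hx', zero_mul]

theorem bind_single_right {X : Type v} (a : Formal R X) : bind a single = a := by
  refine Formal.ext fun y => ?_
  rw [bind_apply, tsum_eq_single y]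
  · rw [single_self, mul_one]
  · intro x' hx'
    rw [single_ne (Ne.symm hx'), mul_zero]

theorem bind_bind {X : Type u} {Y : Type v} {Z : Type w} (a : Formal R X) (k : X → Formal R Y)
    (l : Y → Formal R Z) : bind (bind a k) l = bind a (fun x => bind (k x) l) := by
  refine Formal.ext fun z => ?_
  simp only [bind_apply]
  have hs : Summable (fun p : X × Y => a.1 p.1 * (k p.1).1 p.2 * (l p.2).1 z) :=
    summable_of_tendsto (tendsto_prod a k fun y => (l y).1 z)
  calc ∑' y, (∑' x, a.1 x * (k x).1 y) * (l y).1 z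
      = ∑' y, ∑' x, a.1 x * (k x).1 y * (l y).1 z :=
        tsum_congr fun y => ((summable_mul a fun x => (k x).1 y).tsum_mul_right _).symm
    _ = ∑' x, ∑' y, a.1 x * (k x).1 y * (l y).1 z := Summable.tsum_comm hs
    _ = ∑' x, a.1 x * ∑' y, (k x).1 y * (l y).1 z := by
        refine tsum_congr fun x => ?_
        rw [← (summable_mul (k x) fun y => (l y).1 z).tsum_mul_left]
        exact tsum_congr fun y => mul_assoc _ _ _

theorem bind_add_left {X : Type v} {Y : Type w} (a b : Formal R X) (k : X → Formal R Y) :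
    bind (a + b) k = bind a k + bind b k := by
  refine Formal.ext fun y => ?_
  change ∑' x, (a.1 x + b.1 x) * _ = (∑' x, _) + ∑' x, _
  rw [← (summable_mul a _).tsum_add (summable_mul b _)]
  exact tsum_congr fun x => add_mul _ _ _

theorem bind_add_right {X : Type v} {Y : Type w} (a : Formal R X) (k l : X → Formal R Y) :
    bind a (fun x => k x + l x) = bind a k + bind a l := by
  refine Formal.ext fun y => ?_
  change ∑' x, a.1 x * ((k x).1 y + (l x).1 y) = (∑' x, _) + ∑' x, _
  rw [← (summable_mul a _).tsum_add (summable_mul a _)]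
  exact tsum_congr fun x => mul_add _ _ _

/-- `bind` as a group homomorphism in the first argument. -/
def bindHom {X : Type v} {Y : Type w} (k : X → Formal R Y) : Formal R X →+ Formal R Y :=
  AddMonoidHom.mk' (fun a => bind a k) fun a b => bind_add_left a b k

theorem bindHom_apply {X : Type v} {Y : Type w} (k : X → Formal R Y) (a : Formal R X) :
    bindHom k a = bind a k := rfl

theorem bind_map {X : Type u} {Y : Type v} {Z : Type w} (f : X → Y) (a : Formal R X)
    (k : Y → Formal R Z) : bind (map f a) k = bind a (fun x => k (f x)) := by
  rw [map_eq_bind, bind_bind]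
  simp only [bind_single_left]

theorem map_bind {X : Type u} {Y : Type v} {Z : Type w} (a : Formal R X) (k : X → Formal R Y)
    (f : Y → Z) : map f (bind a k) = bind a (fun x => map f (k x)) := by
  simp only [map_eq_bind, bind_bind]

theorem map_single {X : Type v} {Y : Type w} (f : X → Y) (x : X) :
    map f (single x : Formal R X) = single (f x) := by
  rw [map_eq_bind, bind_single_left]

theorem map_id' {X : Type v} (a : Formal R X) : map id a = a := by
  rw [map_eq_bind]
  exact bind_single_right a

theorem map_map {X : Type u} {Y : Type v} {Z : Type w} (f : X → Y) (g : Y → Z) (a : Formal R X) :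
    map g (map f a) = map (fun x => g (f x)) a := by
  simp only [map_eq_bind g, map_eq_bind (fun x => g (f x)), bind_map]

end FormalCombinations

section Monad

variable (R : Type u) [Ring R] [UniformSpace R] [IsUniformAddGroup R] [IsTopologicalRing R]
  [IsLinearTopology Rᵐᵒᵖ R] [CompleteSpace R] [T2Space R]

/-- The monad `X ↦ R[[X]]` on the category of sets. -/
def monad : Monad (Type u) where
  obj X := Formal R X
  map f := ↾(map f)
  map_id X := ConcreteCategory.hom_ext _ _ fun a => map_id' a
  map_comp f g := ConcreteCategory.hom_ext _ _ fun a => (map_map f g a).symm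
  η :=
    { app X := ↾single
      naturality X Y f := ConcreteCategory.hom_ext _ _ fun x => (map_single f x).symm }
  μ :=
    { app X := ↾join
      naturality X Y f := by
        refine ConcreteCategory.hom_ext _ _ fun t => ?_
        change join (map (map f) t) = map f (join t)
        rw [join_eq_bind, join_eq_bind, bind_map, map_bind]
        rfl }
  assoc X := by
    refine ConcreteCategory.hom_ext _ _ fun t => ?_
    change join (map join t) = join (join t)
    simp only [join_eq_bind, bind_map, bind_bind]
    rfl
  left_unit X := by
    refine ConcreteCategory.hom_ext _ _ fun t => ?_
    change join (single t) = t
    rw [join_eq_bind, bind_single_left]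
    rfl
  right_unit X := by
    refine ConcreteCategory.hom_ext _ _ fun t => ?_
    change join (map single t) = t
    rw [join_eq_bind, bind_map]
    exact bind_single_right t

/-- The category of left contramodules over `R`: algebras over the monad `X ↦ R[[X]]`. -/
abbrev Contra : Type (u + 1) := (monad R).Algebra

/-- The free left contramodule `R[[X]]`, with the contraaction `join`. -/
abbrev freeContra (X : Type u) : Contra R := (monad R).free.obj X

end Monad

section Abelian

variable {R : Type u} [Ring R] [UniformSpace R] [IsUniformAddGroup R] [IsTopologicalRing R]
  [IsLinearTopology Rᵐᵒᵖ R] [CompleteSpace R] [T2Space R]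

/-- The contraaction `π : R[[P]] → P`. -/
def act (P : Contra R) (a : Formal R P.A) : P.A := P.a a

theorem act_single (P : Contra R) (p : P.A) : act P (single p) = p :=
  ConcreteCategory.congr_hom P.unit p

theorem act_join (P : Contra R) (t : Formal R (Formal R P.A)) :
    act P (join t) = act P (map (act P) t) :=
  ConcreteCategory.congr_hom P.assoc t

theorem act_bind (P : Contra R) {X : Type u} (a : Formal R X) (k : X → Formal R P.A) :
    act P (bind a k) = act P (map (fun x => act P (k x)) a) := by
  have h := act_join P (map k a)
  rw [join_eq_bind, bind_map, map_map] at h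
  exact h

theorem act_map_hom {P Q : Contra R} (f : P ⟶ Q) (a : Formal R P.A) :
    act Q (map f.f a) = f.f (act P a) :=
  ConcreteCategory.congr_hom f.h a

theorem act_surjective (P : Contra R) : Function.Surjective (act P) :=
  fun p => ⟨single p, act_single P p⟩

theorem act_congr_bind (P : Contra R) {X : Type u} {a : Formal R X} {k l : X → Formal R P.A}
    (h : ∀ x, act P (k x) = act P (l x)) : act P (bind a k) = act P (bind a l) := by
  rw [act_bind, act_bind, funext h]

theorem act_single_act (P : Contra R) (a : Formal R P.A) : act P (single (act P a)) = act P a :=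
  act_single P _

/-- A binary linear operation on coefficients descends along the contraaction. -/
theorem act_add_congr (P : Contra R) {a a' b b' : Formal R P.A} (ha : act P a = act P a')
    (hb : act P b = act P b') : act P (a + b) = act P (a' + b') := by
  let t : Formal R (ULift.{u} Bool) := single ⟨true⟩ + single ⟨false⟩
  have key : ∀ c d : Formal R P.A, bind t (fun i => if i.down then c else d) = c + d := by
    intro c d
    rw [bind_add_left, bind_single_left, bind_single_left]
    simp
  rw [← key a b, ← key a' b']
  refine act_congr_bind P ?_
  rintro ⟨_ | _⟩
  · exact hb
  · exact ha

theorem act_neg_congr (P : Contra R) {a a' : Formal R P.A} (ha : act P a = act P a') :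
    act P (-a) = act P (-a') := by
  have key : ∀ c : Formal R P.A, bind (-single (PUnit.unit.{u + 1})) (fun _ => c) = -c := by
    intro c
    rw [← bindHom_apply, _root_.map_neg, bindHom_apply, bind_single_left]
  rw [← key a, ← key a']
  exact act_congr_bind P fun _ => ha

theorem act_nsmul_congr (P : Contra R) (n : ℕ) {a a' : Formal R P.A} (ha : act P a = act P a') :
    act P (n • a) = act P (n • a') := by
  induction n with
  | zero => simp only [zero_smul]
  | succ n ih => rw [succ_nsmul, succ_nsmul]; exact act_add_congr P ih ha

theorem act_zsmul_congr (P : Contra R) (n : ℤ) {a a' : Formal R P.A} (ha : act P a = act P a') :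
    act P (n • a) = act P (n • a') := by
  cases n with
  | ofNat n =>
    simp only [Int.ofNat_eq_natCast, natCast_zsmul]
    exact act_nsmul_congr P n ha
  | negSucc n =>
    simp only [negSucc_zsmul]
    exact act_neg_congr P (act_nsmul_congr P _ ha)

/-- The underlying abelian group of a contramodule: finite sums are the values of the
contraaction on the corresponding finite formal linear combinations. -/
instance addCommGroup (P : Contra R) : AddCommGroup P.A :=
  letI : Zero P.A := ⟨act P 0⟩
  letI : Add P.A := ⟨fun p q => act P (single p + single q)⟩
  letI : Neg P.A := ⟨fun p => act P (-single p)⟩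
  letI : Sub P.A := ⟨fun p q => act P (single p - single q)⟩
  letI : SMul ℕ P.A := ⟨fun n p => act P (n • single p)⟩
  letI : SMul ℤ P.A := ⟨fun n p => act P (n • single p)⟩
  Function.Surjective.addCommGroup (act P) (act_surjective P) rfl
    (fun a b => (act_add_congr P (act_single_act P a) (act_single_act P b)).symm)
    (fun a => (act_neg_congr P (act_single_act P a)).symm)
    (fun a b => by
      change act P (a - b) = act P (single (act P a) - single (act P b))
      rw [sub_eq_add_neg, sub_eq_add_neg]
      exact (act_add_congr P (act_single_act P a)
        (act_neg_congr P (act_single_act P b))).symm)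
    (fun a n => (act_nsmul_congr P n (act_single_act P a)).symm)
    (fun a n => (act_zsmul_congr P n (act_single_act P a)).symm)

theorem act_add (P : Contra R) (a b : Formal R P.A) : act P (a + b) = act P a + act P b :=
  (act_add_congr P (act_single_act P a) (act_single_act P b)).symm

/-- The contraaction as a group homomorphism. -/
def actHom (P : Contra R) : Formal R P.A →+ P.A := AddMonoidHom.mk' (act P) (act_add P)

theorem act_neg (P : Contra R) (a : Formal R P.A) : act P (-a) = -act P a :=
  _root_.map_neg (actHom P) a

theorem act_zero (P : Contra R) : act P 0 = 0 := _root_.map_zero (actHom P)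

/-- The contraaction is additive in the family of elements. -/
theorem act_map_add (P : Contra R) {X : Type u} (a : Formal R X) (f g : X → P.A) :
    act P (map (fun x => f x + g x) a) = act P (map f a) + act P (map g a) := by
  have h := act_bind P a (fun x => single (f x) + single (g x))
  rw [bind_add_right, act_add, ← map_eq_bind, ← map_eq_bind] at h
  simp only [act_add, act_single] at h
  exact h.symm

/-- `f ↦ ∑ a x • f x` as a group homomorphism, for fixed coefficients `a`. -/
def familyHom (P : Contra R) {X : Type u} (a : Formal R X) : (X → P.A) →+ P.A :=
  AddMonoidHom.mk' (fun f => act P (map f a)) (act_map_add P a)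

theorem familyHom_apply (P : Contra R) {X : Type u} (a : Formal R X) (f : X → P.A) :
    familyHom P a f = act P (map f a) := rfl

theorem hom_add {P Q : Contra R} (f : P ⟶ Q) (p q : P.A) : f.f (p + q) = f.f p + f.f q := by
  obtain ⟨a, rfl⟩ := act_surjective P p
  obtain ⟨b, rfl⟩ := act_surjective P q
  rw [← act_add, ← act_map_hom, ← act_map_hom, ← act_map_hom, ← act_add]
  rw [map_eq_bind, map_eq_bind, map_eq_bind, bind_add_left]

/-- A morphism of contramodules as a group homomorphism. -/
def homAdd {P Q : Contra R} (f : P ⟶ Q) : P.A →+ Q.A := AddMonoidHom.mk' f.f (hom_add f)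

theorem homAdd_apply {P Q : Contra R} (f : P ⟶ Q) (p : P.A) : homAdd f p = f.f p := rfl

/-- Constructor for morphisms of contramodules. -/
def homMk {P Q : Contra R} (f : P.A → Q.A)
    (h : ∀ a : Formal R P.A, act Q (map f a) = f (act P a)) : P ⟶ Q where
  f := ↾f
  h := ConcreteCategory.hom_ext _ _ h

theorem homMk_apply {P Q : Contra R} (f : P.A → Q.A)
    (h : ∀ a : Formal R P.A, act Q (map f a) = f (act P a)) (p : P.A) : (homMk f h).f p = f p := rfl

theorem contraHom_ext {P Q : Contra R} {f g : P ⟶ Q} (h : ∀ p, f.f p = g.f p) : f = g :=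
  Monad.Algebra.Hom.ext' _ _ _ _ (ConcreteCategory.hom_ext _ _ h)

theorem comp_apply {P Q S : Contra R} (f : P ⟶ Q) (g : Q ⟶ S) (p : P.A) :
    (f ≫ g).f p = g.f (f.f p) := rfl

/-- The subgroup of morphisms of contramodules in the group of all maps. -/
def homSubgroup (P Q : Contra R) : AddSubgroup (P.A → Q.A) where
  carrier := {f | ∀ a : Formal R P.A, familyHom Q a f = f (act P a)}
  zero_mem' a := _root_.map_zero _
  add_mem' {f g} hf hg a := by rw [_root_.map_add, hf a, hg a]; rfl
  neg_mem' {f} hf a := by rw [_root_.map_neg, hf a]; rfl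

/-- Morphisms of contramodules are the elements of `homSubgroup`. -/
def homEquivSubgroup (P Q : Contra R) : (P ⟶ Q) ≃ homSubgroup P Q where
  toFun f := ⟨f.f, act_map_hom f⟩
  invFun f := homMk f.1 f.2
  left_inv _ := rfl
  right_inv _ := rfl

/-- Morphisms of contramodules are added pointwise. -/
instance (P Q : Contra R) : AddCommGroup (P ⟶ Q) := (homEquivSubgroup P Q).addCommGroup

theorem hom_add_apply {P Q : Contra R} (f g : P ⟶ Q) (p : P.A) :
    (f + g).f p = f.f p + g.f p := rfl

instance : Preadditive (Contra R) where
  add_comp P Q S f f' g := contraHom_ext fun p => hom_add g _ _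
  comp_add P Q S f g g' := contraHom_ext fun p => rfl

theorem zero_apply {P Q : Contra R} (p : P.A) : (0 : P ⟶ Q).f p = 0 := rfl

instance : HasLimits (Contra R) :=
  ⟨fun _ _ => ⟨fun D => Monad.hasLimit_of_comp_forget_hasLimit D⟩⟩

instance : HasFiniteProducts (Contra R) := inferInstance

instance : HasKernels (Contra R) := inferInstance

theorem mono_iff {P Q : Contra R} (f : P ⟶ Q) : Mono f ↔ Function.Injective f.f := by
  constructor
  · intro h
    have : Mono ((monad R).forget.map f) := inferInstance
    exact (CategoryTheory.mono_iff_injective _).1 this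
  · intro h
    have : Mono f.f := (CategoryTheory.mono_iff_injective _).2 h
    exact Monad.algebra_mono_of_mono _ f

/-- The range of a morphism, as a subgroup. -/
abbrev rangeSub {P Q : Contra R} (f : P ⟶ Q) : AddSubgroup Q.A := (homAdd f).range

/-- The range of a morphism is closed under the contraaction. -/
theorem act_mem_range {P Q : Contra R} (f : P ⟶ Q) {X : Type u} (a : Formal R X) (k : X → Q.A)
    (h : ∀ x, k x ∈ rangeSub f) : act Q (map k a) ∈ rangeSub f := by
  choose l hl using h
  refine ⟨act P (map l a), ?_⟩
  rw [homAdd_apply, ← act_map_hom, map_map]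
  exact congrArg (fun k => act Q (map k a)) (funext hl)

theorem act_map_sub_mem_range {P Q : Contra R} (f : P ⟶ Q) {X : Type u} (a : Formal R X)
    (k l : X → Q.A) (h : ∀ x, k x - l x ∈ rangeSub f) :
    act Q (map k a) - act Q (map l a) ∈ rangeSub f := by
  rw [← familyHom_apply, ← familyHom_apply, ← _root_.map_sub]
  exact act_mem_range f a _ h

/-- The quotient of the codomain of `f` by the range of `f`. -/
abbrev quotType {P Q : Contra R} (f : P ⟶ Q) : Type u := Q.A ⧸ rangeSub f

/-- The contraaction of the quotient, computed on representatives. -/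
def quotAct {P Q : Contra R} (f : P ⟶ Q) (a : Formal R (quotType f)) : quotType f :=
  (QuotientAddGroup.mk (act Q (map Quotient.out a)) : quotType f)

theorem quotAct_map {P Q : Contra R} (f : P ⟶ Q) {X : Type u} (a : Formal R X) (k : X → Q.A) :
    quotAct f (map (fun x => (QuotientAddGroup.mk (k x) : quotType f)) a) =
      QuotientAddGroup.mk (act Q (map k a)) := by
  unfold quotAct
  rw [map_map]
  refine (QuotientAddGroup.eq_iff_sub_mem).2 (act_map_sub_mem_range f a _ _ fun x => ?_)
  exact (QuotientAddGroup.eq_iff_sub_mem).1 (QuotientAddGroup.out_eq' _)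

/-- The quotient contramodule of the codomain of `f` by the range of `f`. -/
def quot {P Q : Contra R} (f : P ⟶ Q) : Contra R where
  A := quotType f
  a := ↾(quotAct f)
  unit := ConcreteCategory.hom_ext _ _ fun p => by
    change quotAct f (single p) = p
    unfold quotAct
    rw [map_single, act_single]
    exact QuotientAddGroup.out_eq' _
  assoc := ConcreteCategory.hom_ext _ _ fun (t : Formal R (Formal R (quotType f))) => by
    change quotAct f (join t) = quotAct f (map (quotAct f) t)
    have h := quotAct_map f t (fun s => act Q (map Quotient.out s))
    refine Eq.trans ?_ h.symm
    unfold quotAct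
    rw [join_eq_bind, map_bind, act_bind]
    rfl

/-- The projection to the quotient contramodule. -/
def quotProj {P Q : Contra R} (f : P ⟶ Q) : Q ⟶ quot f :=
  homMk (Q := quot f) (fun q => (QuotientAddGroup.mk q : quotType f)) fun a => by
    have h := quotAct_map f a id
    rw [map_id'] at h
    exact h

theorem quotProj_surjective {P Q : Contra R} (f : P ⟶ Q) :
    Function.Surjective (quotProj f).f :=
  QuotientAddGroup.mk_surjective

theorem quotProj_eq_zero {P Q : Contra R} (f : P ⟶ Q) (q : Q.A) :
    (quotProj f).f q = 0 ↔ q ∈ rangeSub f := by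
  have h : (quotProj f).f (0 : Q.A) = 0 := _root_.map_zero (homAdd (quotProj f))
  rw [← h]
  exact (QuotientAddGroup.eq_iff_sub_mem).trans (by rw [sub_zero])

theorem comp_quotProj {P Q : Contra R} (f : P ⟶ Q) : f ≫ quotProj f = 0 :=
  contraHom_ext fun p => (quotProj_eq_zero f _).2 ⟨p, rfl⟩

theorem map_surjective {X Y : Type u} {f : X → Y} (hf : Function.Surjective f) :
    Function.Surjective (map f : Formal R X → Formal R Y) := fun b =>
  ⟨map (Function.surjInv hf) b, by
    rw [map_map, funext (Function.surjInv_eq hf)]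
    exact map_id' b⟩

/-- Descent of a morphism along a surjective morphism whose kernel it annihilates. -/
def desc {Q S T : Contra R} (g : Q ⟶ S) (hg : Function.Surjective g.f) (h : Q ⟶ T)
    (hk : ∀ q, g.f q = 0 → h.f q = 0) : S ⟶ T :=
  homMk (fun s => h.f (Function.surjInv hg s)) fun a => by
    have hd : ∀ q, h.f (Function.surjInv hg (g.f q)) = h.f q := fun q => by
      rw [← sub_eq_zero]
      refine Eq.trans (_root_.map_sub (homAdd h) _ _).symm (hk _ ?_)
      refine Eq.trans (_root_.map_sub (homAdd g) _ _) (sub_eq_zero.2 ?_)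
      exact Function.surjInv_eq hg _
    obtain ⟨b, rfl⟩ := map_surjective hg a
    rw [map_map, act_map_hom g b, hd]
    have hd' : (fun q => h.f (Function.surjInv hg (g.f q))) = h.f := funext hd
    rw [hd', act_map_hom]

theorem comp_desc {Q S T : Contra R} (g : Q ⟶ S) (hg : Function.Surjective g.f) (h : Q ⟶ T)
    (hk : ∀ q, g.f q = 0 → h.f q = 0) : g ≫ desc g hg h hk = h := contraHom_ext fun q => by
  change h.f (Function.surjInv hg (g.f q)) = h.f q
  rw [← sub_eq_zero]
  refine Eq.trans (_root_.map_sub (homAdd h) _ _).symm (hk _ ?_)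
  refine Eq.trans (_root_.map_sub (homAdd g) _ _) (sub_eq_zero.2 ?_)
  exact Function.surjInv_eq hg _

theorem epi_of_surjective {P Q : Contra R} {f : P ⟶ Q} (h : Function.Surjective f.f) : Epi f :=
  have : Epi f.f := (CategoryTheory.epi_iff_surjective _).2 h
  Monad.algebra_epi_of_epi _ f

theorem epi_iff {P Q : Contra R} (f : P ⟶ Q) : Epi f ↔ Function.Surjective f.f := by
  refine ⟨fun h q => ?_, epi_of_surjective⟩
  have h0 : quotProj f = 0 := by
    rw [← cancel_epi f, comp_quotProj, comp_zero]
  have : (quotProj f).f q = 0 := by rw [h0]; rfl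
  exact (quotProj_eq_zero f q).1 this

/-- A surjective morphism is a cokernel of any morphism that ranges over its kernel. -/
theorem nonempty_isColimit {P Q S : Contra R} (f : P ⟶ Q) (g : Q ⟶ S) (w : f ≫ g = 0)
    (hg : Function.Surjective g.f) (hk : ∀ q, g.f q = 0 → ∃ p, f.f p = q) :
    Nonempty (IsColimit (CokernelCofork.ofπ g w)) := by
  have : Epi g := epi_of_surjective hg
  refine ⟨CokernelCofork.IsColimit.ofπ' g w fun {T} h hw => ⟨desc g hg h fun q hq => ?_,
    comp_desc g hg h _⟩⟩
  obtain ⟨p, rfl⟩ := hk q hq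
  exact ConcreteCategory.congr_hom (congrArg Monad.Algebra.Hom.f hw) p

/-- An injective morphism is a kernel of any morphism whose kernel is its range. -/
theorem nonempty_isLimit {P Q S : Contra R} (f : P ⟶ Q) (g : Q ⟶ S) (w : f ≫ g = 0)
    (hf : Function.Injective f.f) (hk : ∀ q, g.f q = 0 → ∃ p, f.f p = q) :
    Nonempty (IsLimit (KernelFork.ofι f w)) := by
  have : Mono f := (mono_iff f).2 hf
  refine ⟨KernelFork.IsLimit.ofι' f w fun {T} h hw => ?_⟩
  have hex : ∀ t, ∃ p, f.f p = h.f t := fun t =>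
    hk _ (ConcreteCategory.congr_hom (congrArg Monad.Algebra.Hom.f hw) t)
  choose l hl using hex
  refine ⟨homMk l fun a => hf ?_, contraHom_ext hl⟩
  rw [← act_map_hom, map_map, funext hl, act_map_hom, hl]

instance : HasCokernels (Contra R) where
  has_colimit f := by
    obtain ⟨h⟩ := nonempty_isColimit f (quotProj f) (comp_quotProj f) (quotProj_surjective f)
      fun q hq => (quotProj_eq_zero f q).1 hq
    exact ⟨⟨⟨_, h⟩⟩⟩

/-- The category of left contramodules is abelian. -/
instance : Abelian (Contra R) where
  normalMonoOfMono f _ := by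
    obtain ⟨h⟩ := nonempty_isLimit f (quotProj f) (comp_quotProj f) ((mono_iff f).1 inferInstance)
      fun q hq => (quotProj_eq_zero f q).1 hq
    exact ⟨⟨quot f, quotProj f, comp_quotProj f, h⟩⟩
  normalEpiOfEpi {P Q} g _ := by
    have hmem : ∀ q : P.A, g.f q = 0 → ∃ p, (kernel.ι g).f p = q := by
      intro q hq
      let φ : (monad R).free.obj PUnit ⟶ P :=
        ((monad R).adj.homEquiv PUnit P).symm (↾fun _ => q)
      have hφ : (monad R).adj.homEquiv PUnit P φ = ↾fun _ => q :=
        Equiv.apply_symm_apply _ _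
      have hφ' : φ.f (single PUnit.unit) = q := ConcreteCategory.congr_hom hφ PUnit.unit
      have hw : φ ≫ g = 0 := by
        apply ((monad R).adj.homEquiv PUnit Q).injective
        refine ConcreteCategory.hom_ext _ _ fun x => ?_
        change g.f (φ.f (single PUnit.unit)) = 0
        rw [hφ', hq]
      refine ⟨(kernel.lift g φ hw).f (single PUnit.unit), Eq.trans ?_ hφ'⟩
      exact ConcreteCategory.congr_hom
        (congrArg Monad.Algebra.Hom.f (kernel.lift_ι g φ hw)) (single PUnit.unit)
    obtain ⟨h⟩ := nonempty_isColimit (kernel.ι g) g (kernel.condition g)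
      ((epi_iff g).1 inferInstance) hmem
    exact ⟨⟨kernel g, kernel.ι g, kernel.condition g, h⟩⟩

end Abelian

end Contramodule

namespace Cotorsion

variable {K : Type u} [Category.{v} K] [Abelian K]

section Perp

variable [HasExt.{w} K]

/-- `A^⊥`: the objects `Y` with `Ext¹(X, Y) = 0` for all `X` in `A`. -/
def rightPerp (A : ObjectProperty K) : ObjectProperty K :=
  fun Y => ∀ X, A X → Subsingleton (Abelian.Ext X Y 1)

/-- `^⊥B`: the objects `X` with `Ext¹(X, Y) = 0` for all `Y` in `B`. -/
def leftPerp (B : ObjectProperty K) : ObjectProperty K :=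
  fun X => ∀ Y, B Y → Subsingleton (Abelian.Ext X Y 1)

/-- `(F, C)` is a cotorsion theory: `C = F^⊥` and `F = ^⊥C`. -/
structure IsCotorsionTheory (F C : ObjectProperty K) : Prop where
  right_eq : C = rightPerp F
  left_eq : F = leftPerp C

/-- `(F, C)` is the cotorsion theory generated by `S`: it is a cotorsion theory and `C = S^⊥`. -/
structure IsGeneratedBy (F C S : ObjectProperty K) : Prop extends IsCotorsionTheory F C where
  right_eq_perp : C = rightPerp S

end Perp

/-- A special `F`-precover of `X`: an epimorphism onto `X` from an object of `F`, with kernel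
in `C`. -/
def HasSpecialPrecover (F C : ObjectProperty K) (X : K) : Prop :=
  ∃ (P : K) (f : P ⟶ X), F P ∧ Epi f ∧ C (kernel f)

/-- A special `C`-preenvelope of `X`: a monomorphism from `X` to an object of `C`, with cokernel
in `F`. -/
def HasSpecialPreenvelope (F C : ObjectProperty K) (X : K) : Prop :=
  ∃ (E : K) (f : X ⟶ E), C E ∧ Mono f ∧ F (cokernel f)

/-- `Filt(S)`: transfinitely iterated extensions, in the sense of the directed colimit, of objects
of `S`. The well-ordered set `J` with a largest element is the set of ordinals `i ≤ α` for an
ordinal `α`, and `D` is a smooth chain `(D i)_{i ≤ α}`: well-order continuity means that `D j` is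
the colimit of `D i` over `i < j` for all limit `j`. It is required that `D 0 = 0`, `D α = X`,
and that each `D i → D (i + 1)`, `i < α`, is a monomorphism with cokernel isomorphic to an
object of `S`. -/
def Filt (S : ObjectProperty K) : ObjectProperty K := fun X =>
  ∃ (J : Type v) (_ : LinearOrder J) (_ : OrderBot J) (_ : OrderTop J) (_ : SuccOrder J)
    (_ : WellFoundedLT J) (D : J ⥤ K),
    D.IsWellOrderContinuous ∧ IsZero (D.obj ⊥) ∧ Nonempty (D.obj ⊤ ≅ X) ∧
      ∀ i : J, i ≠ ⊤ →
        Mono (D.map (homOfLE (Order.le_succ i))) ∧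
          ∃ Y, S Y ∧ Nonempty (cokernel (D.map (homOfLE (Order.le_succ i))) ≅ Y)

/-- `X` is a direct summand of an object of `A`. -/
def IsSummandOf (A : ObjectProperty K) : ObjectProperty K :=
  fun X => ∃ X' Y : K, A Y ∧ Nonempty (X ⊞ X' ≅ Y)

end Cotorsion

namespace Contramodule

instance (R : Type u) [Ring R] [UniformSpace R] [IsUniformAddGroup R] [IsTopologicalRing R]
    [IsLinearTopology Rᵐᵒᵖ R] [CompleteSpace R] [T2Space R] : HasExt.{u + 1} (Contra R) :=
  HasExt.standard _

end Contramodule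

end

/-! Vanishing of `Ext¹` is a lifting property. If `Ext¹(X, Y) = 0`, every monomorphism with cokernel
`X` lifts against every epimorphism with kernel `Y` (`llp_of_subsingleton_ext`); conversely, if `0 →
X` lifts against these epimorphisms, then `Ext¹(X, Y) = 0` (`subsingleton_ext_of_llp`). Left lifting
classes are closed under pushouts and transfinite compositions, so Eklof's lemma
(`subsingleton_ext_of_filt`) needs no exactness of directed colimits, which may fail for
contramodules.

Cover each object of `S` by a free contramodule and take as cells the inclusions of the kernels,
together with `0 → R`. Right lifting against `0 → R` forces surjectivity, and a surjection with
right lifting against the other cells has its kernel in `C`. The small object argument applied to `0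
→ P` yields the special precover, and applied to `P → 0` it yields the special preenvelope. In the
second case a transfinite composition of monomorphisms need not be a monomorphism; the embedding of
`P` into an object of `C` repairs this. For the third assertion, the special precover of an object
of `F` splits, and the converse is Eklof's lemma.

Smallness comes from the countable base: formal combinations have countable support
(`countable_support`), so the monad preserves countably directed colimits, and a map from a fixed
contramodule to the colimit of a long enough chain factors through a stage
(`exists_factorization_of_isColimit`). Cells are attached one at a time, since `Filt` asks each
successive cokernel to be a single object of `S ∪ {R}`; the states of `CellularFactorization` carry
a list of scheduled lifting problems that ensures all problems get solved. -/

noncomputable section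

namespace Contramodule

set_option linter.unusedSectionVars false

/-! ### Free contramodules, and colimits by generators and relations. -/

section Colimits

variable {R : Type u} [Ring R] [UniformSpace R] [IsUniformAddGroup R] [IsTopologicalRing R]
  [IsLinearTopology Rᵐᵒᵖ R] [CompleteSpace R] [T2Space R]

/-- The morphism from a free contramodule that is given by the images of the generators. -/
def freeLift {X : Type u} {P : Contra R} (k : X → P.A) : freeContra R X ⟶ P :=
  homMk (P := freeContra R X) (fun a : Formal R X => act P (map k a))
    fun (t : Formal R (Formal R X)) => by
      change _ = act P (map k (join t))
      rw [join_eq_bind, map_bind, act_bind]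
      rfl

/-- The elements of a free contramodule are the formal linear combinations. -/
def comb {X : Type u} (a : Formal R X) : (freeContra R X).A := a

/-- The free generators of a free contramodule. -/
def gen {X : Type u} (x : X) : (freeContra R X).A := comb (single x)

theorem freeLift_comb {X : Type u} {P : Contra R} (k : X → P.A) (a : Formal R X) :
    (freeLift k).f (comb a) = act P (map k a) := rfl

theorem freeLift_gen {X : Type u} {P : Contra R} (k : X → P.A) (x : X) :
    (freeLift k).f (gen x) = k x := by
  rw [gen, freeLift_comb, map_single, act_single]

theorem act_map_gen {X Y : Type u} (f : X → Y) (a : Formal R X) :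
    act (freeContra R Y) (map (fun x => gen (f x)) a) = comb (map f a) := by
  have h : join (map (fun x => (single (f x) : Formal R Y)) a) = map f a := by
    rw [join_eq_bind, bind_map, map_eq_bind]
    rfl
  exact h

theorem hom_congr {P Q : Contra R} {f g : P ⟶ Q} (h : f = g) (p : P.A) : f.f p = g.f p := by
  rw [h]

theorem freeHom_ext {X : Type u} {P : Contra R} {f g : freeContra R X ⟶ P}
    (h : ∀ x : X, f.f (gen x) = g.f (gen x)) : f = g := by
  have hf : ∀ (f : freeContra R X ⟶ P) (a : Formal R X),
      f.f (comb a) = act P (map (fun x => f.f (gen x)) a) := fun f a => by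
    have ha := act_map_hom f (map gen a)
    rw [map_map, act_map_gen (R := R) (fun x => x) a] at ha
    rw [ha]
    exact congrArg (fun a => f.f (comb a)) (map_id' a).symm
  exact contraHom_ext fun a => ((hf f a).trans (by rw [funext h])).trans (hf g a).symm

theorem hom_sub {P Q : Contra R} (f : P ⟶ Q) (p q : P.A) : f.f (p - q) = f.f p - f.f q :=
  _root_.map_sub (homAdd f) p q

variable {J : Type u} [Category.{u} J] (D : J ⥤ Contra R)

/-- The relations between the generators `Σ j, D j` of the colimit of a diagram `D`. -/
abbrev ColimitRelations : Type u :=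
  (Σ j, Formal R (D.obj j).A) ⊕ (Σ (j j' : J), (j ⟶ j') × (D.obj j).A)

/-- The elements of the free contramodule corresponding to `ColimitRelations`. -/
def colimitRelation : ColimitRelations D → (freeContra R (Σ j, (D.obj j).A)).A
  | .inl ⟨j, a⟩ => comb (map (Sigma.mk j) a) - gen ⟨j, act (D.obj j) a⟩
  | .inr ⟨j, j', φ, x⟩ => gen ⟨j, x⟩ - gen ⟨j', (D.map φ).f x⟩

/-- The presentation of the colimit of a diagram of contramodules. -/
def colimitPresentation :
    freeContra R (ColimitRelations D) ⟶ freeContra R (Σ j, (D.obj j).A) :=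
  freeLift (colimitRelation D)

theorem colimitProj_eq (r : ColimitRelations D) {a b : (freeContra R (Σ j, (D.obj j).A)).A}
    (h : colimitRelation D r = a - b) :
    (quotProj (colimitPresentation D)).f a = (quotProj (colimitPresentation D)).f b := by
  rw [← sub_eq_zero, ← hom_sub, quotProj_eq_zero]
  exact ⟨gen r, (freeLift_gen _ r).trans h⟩

/-- The colimit cocone of a diagram of contramodules. -/
def colimitCocone : Cocone D where
  pt := quot (colimitPresentation D)
  ι :=
    { app j := homMk (Q := quot (colimitPresentation D))
        (fun x => (quotProj (colimitPresentation D)).f (gen ⟨j, x⟩)) fun a => by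
          have h := act_map_hom (quotProj (colimitPresentation D))
            (map (fun x => gen (R := R) (Sigma.mk j x)) a)
          rw [map_map, act_map_gen] at h
          exact h.trans (colimitProj_eq D (.inl ⟨j, a⟩) rfl)
      naturality j j' φ := contraHom_ext fun x =>
        (colimitProj_eq D (.inr ⟨j, j', φ, x⟩) rfl).symm }

/-- Relations of the first kind die because the legs of the cocone are morphisms of contramodules,
those of the second kind because the legs are natural. -/
theorem colimitPresentation_comp_freeLift (s : Cocone D) :
    colimitPresentation D ≫ freeLift (fun x : Σ j, (D.obj j).A => (s.ι.app x.1).f x.2) = 0 := by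
  refine freeHom_ext fun r => ?_
  rw [comp_apply, colimitPresentation, freeLift_gen, zero_apply]
  obtain (⟨j, a⟩ | ⟨j, j', φ, x⟩) := r
  · refine (hom_sub _ _ _).trans (sub_eq_zero.2 ?_)
    rw [freeLift_gen, freeLift_comb, map_map]
    exact act_map_hom (s.ι.app j) a
  · refine (hom_sub _ _ _).trans (sub_eq_zero.2 ?_)
    rw [freeLift_gen, freeLift_gen]
    exact (hom_congr (s.w φ) x).symm

/-- The universal property of `colimitCocone`. -/
def isColimitColimitCocone : IsColimit (colimitCocone D) where
  desc s := desc (quotProj (colimitPresentation D)) (quotProj_surjective _)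
    (freeLift fun x : Σ j, (D.obj j).A => (s.ι.app x.1).f x.2) fun q hq => by
      obtain ⟨p, rfl⟩ := (quotProj_eq_zero _ _).1 hq
      exact hom_congr (colimitPresentation_comp_freeLift D s) p
  fac s j := contraHom_ext fun x => by
    refine (hom_congr (comp_desc (quotProj (colimitPresentation D)) (quotProj_surjective _)
      _ _) (gen ⟨j, x⟩)).trans ?_
    exact freeLift_gen _ _
  uniq s m hm := by
    have : Epi (quotProj (colimitPresentation D)) := epi_of_surjective (quotProj_surjective _)
    refine (cancel_epi (quotProj (colimitPresentation D))).1 ?_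
    refine Eq.trans ?_ (comp_desc (quotProj (colimitPresentation D)) _ _ _).symm
    refine freeHom_ext fun x => ?_
    rw [freeLift_gen]
    exact hom_congr (hm x.1) x.2

instance : HasColimitsOfSize.{u, u} (Contra R) :=
  ⟨fun _ _ => ⟨fun D => ⟨⟨⟨colimitCocone D, isColimitColimitCocone D⟩⟩⟩⟩⟩

/-- The elements of a diagram generate its colimit. -/
theorem epi_freeLift_of_isColimit {D : J ⥤ Contra R} {c : Cocone D} (hc : IsColimit c) :
    Epi (freeLift fun x : Σ j, (D.obj j).A => (c.ι.app x.1).f x.2) where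
  left_cancellation f g h := hc.hom_ext fun j => contraHom_ext fun x => by
    have h' := hom_congr h (gen ⟨j, x⟩)
    rw [comp_apply, comp_apply, freeLift_gen] at h'
    exact h'

end Colimits

/-! ### Supports and direct images of formal combinations. -/

section FilteredColimits

variable {R : Type u} [Ring R] [UniformSpace R] [IsUniformAddGroup R] [IsTopologicalRing R]
  [IsLinearTopology Rᵐᵒᵖ R] [CompleteSpace R] [T2Space R] 

/-- As `R` is Hausdorff, a nonzero coefficient lies outside some `U n` of a countable base; for each
`n` only finitely many coefficients do. The smallness of contramodules rests on this. -/
theorem countable_support [(𝓝 (0 : R)).IsCountablyGenerated] {X : Type v} (a : Formal R X) :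
    (Function.support a.1).Countable := by
  obtain ⟨U, hU⟩ := (𝓝 (0 : R)).exists_antitone_basis
  have h : Function.support a.1 ⊆ ⋃ n, {x | a.1 x ∉ U n} := fun x hx => by
    by_contra hcon
    simp only [Set.mem_iUnion, not_exists, Set.mem_ofPred_eq, not_not] at hcon
    refine hx ?_
    by_contra h0
    obtain ⟨n, -, hn⟩ := hU.1.mem_iff.1 (isOpen_compl_singleton.mem_nhds (Ne.symm h0))
    exact hn (hcon n) rfl
  refine Set.Countable.mono h (Set.countable_iUnion fun n => Set.Finite.countable ?_)
  exact a.2 (hU.1.mem_of_mem trivial)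

/-- A formal combination whose support lies in the range of an injective map is the direct image
of its restriction. -/
theorem map_comp_of_injective {X Y : Type u} {f : X → Y} (hf : Function.Injective f)
    (b : Formal R Y) (hb : Function.support b.1 ⊆ Set.range f) :
    ∃ a : Formal R X, map f a = b ∧ a.1 = b.1 ∘ f := by
  refine ⟨⟨b.1 ∘ f, b.2.comp hf.tendsto_cofinite⟩, Formal.ext fun y => ?_, rfl⟩
  rw [map_eq_bind, bind_apply]
  by_cases hy : y ∈ Set.range f
  · obtain ⟨x, rfl⟩ := hy
    rw [tsum_eq_single x, single_self, mul_one]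
    · rfl
    · intro x' hx'
      rw [single_ne (fun h => hx' (hf h).symm), mul_zero]
  · have h0 : b.1 y = 0 := by
      by_contra h
      exact hy (hb h)
    rw [h0]
    refine (tsum_congr fun x => ?_).trans tsum_zero
    rw [single_ne (fun h => hy ⟨x, h.symm⟩), mul_zero]

theorem map_apply_of_injective {X Y : Type u} {f : X → Y} (hf : Function.Injective f)
    (a : Formal R X) (x : X) : (map f a).1 (f x) = a.1 x := by
  rw [map_eq_bind, bind_apply, tsum_eq_single x, single_self, mul_one]
  intro x' hx'
  rw [single_ne (fun h => hx' (hf h).symm), mul_zero]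

/-- Direct images are supported in the image of the support. -/
theorem support_map {X Y : Type u} (f : X → Y) (a : Formal R X) :
    Function.support (map f a).1 ⊆ f '' Function.support a.1 := by
  intro y hy
  by_contra hcon
  refine hy ?_
  rw [map_eq_bind, bind_apply]
  refine (tsum_congr fun x => ?_).trans tsum_zero
  by_cases hx : a.1 x = 0
  · rw [hx, zero_mul]
  · rw [single_ne (fun h => hcon ⟨x, hx, h.symm⟩), mul_zero]

end FilteredColimits

end Contramodule

namespace Contramodule

/-! ### Countably directed colimits and smallness. -/

section FilteredColimits

variable {R : Type u} [Ring R] [UniformSpace R] [IsUniformAddGroup R] [IsTopologicalRing R]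
  [IsLinearTopology Rᵐᵒᵖ R] [CompleteSpace R] [T2Space R] [(𝓝 (0 : R)).IsCountablyGenerated]

/-- In a preorder where all sequences are bounded, all countable families are bounded. -/
theorem exists_bound_of_countable {J : Type u} [Preorder J] [Nonempty J]
    (hJ : ∀ s : ℕ → J, ∃ j, ∀ n, s n ≤ j) {K : Type v} [Countable K] (s : K → J) :
    ∃ j, ∀ k, s k ≤ j := by
  cases isEmpty_or_nonempty K
  · exact ⟨Classical.arbitrary J, fun k => isEmptyElim k⟩
  · obtain ⟨e, he⟩ := exists_surjective_nat K
    obtain ⟨j, hj⟩ := hJ (s ∘ e)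
    refine ⟨j, fun k => ?_⟩
    obtain ⟨n, rfl⟩ := he k
    exact hj n

theorem isDirected_of_bounded_sequences {J : Type u} [Preorder J] [Nonempty J]
    (hJ : ∀ s : ℕ → J, ∃ j, ∀ n, s n ≤ j) : IsDirected J (· ≤ ·) where
  directed a b := by
    obtain ⟨j, hj⟩ := exists_bound_of_countable hJ (fun i : Bool => cond i a b)
    exact ⟨j, hj true, hj false⟩

variable {J : Type u} [Preorder J] [Nonempty J]

/-- Formal combinations in a colimit of a countably directed diagram of sets come from
its terms. -/
theorem exists_map_eq (hJ : ∀ s : ℕ → J, ∃ j, ∀ n, s n ≤ j) {F : J ⥤ Type u} {c : Cocone F}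
    (hc : IsColimit c) (b : Formal R c.pt) :
    ∃ (j : J) (a : Formal R (F.obj j)), b = map (c.ι.app j) a := by
  have hb := countable_support b
  have : Countable (Function.support b.1) := hb
  have h : ∀ y : c.pt, ∃ (j : J) (x : F.obj j), c.ι.app j x = y := fun y =>
    Types.jointly_surjective_of_isColimit hc y
  choose i x hx using h
  -- The support is countable, so representatives of all its elements can be moved to one stage.
  obtain ⟨j, hj⟩ := exists_bound_of_countable hJ fun y : Function.support b.1 => i y.1
  obtain ⟨a, ha, -⟩ := map_comp_of_injective (f := (Subtype.val : Function.support b.1 → c.pt))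
    Subtype.val_injective b (by simp)
  refine ⟨j, map (fun y => F.map (homOfLE (hj y)) (x y.1)) a, ?_⟩
  rw [map_map]
  refine ha.symm.trans (congrArg (fun k => map k a) (funext fun y => ?_))
  exact (hx y.1).symm.trans (ConcreteCategory.congr_hom (c.w (homOfLE (hj y))) (x y.1)).symm

/-- Formal combinations in a term of a countably directed diagram of sets that agree in
the colimit agree in some term. -/
theorem exists_map_eq_map (hJ : ∀ s : ℕ → J, ∃ j, ∀ n, s n ≤ j) {F : J ⥤ Type u} {c : Cocone F}
    (hc : IsColimit c) {i : J} (a a' : Formal R (F.obj i))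
    (h : map (c.ι.app i) a = map (c.ι.app i) a') :
    ∃ (j : J) (φ : i ⟶ j), map (F.map φ) a = map (F.map φ) a' := by
  have := isDirected_of_bounded_sequences hJ
  let W : Set (F.obj i) := Function.support a.1 ∪ Function.support a'.1
  have hW : Countable W := ((countable_support a).union (countable_support a')).to_subtype
  let P := {p : W × W // c.ι.app i p.1.1 = c.ι.app i p.2.1}
  have hP : ∀ p : P, ∃ (j : J) (φ : i ⟶ j), F.map φ p.1.1.1 = F.map φ p.1.2.1 := fun p =>
    (Types.FilteredColimit.isColimit_eq_iff' hc _ _).1 p.2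
  choose k φ hφ using hP
  -- The value `i` at `none` puts `j` above `i` even if there are no pairs to identify.
  obtain ⟨j, hj⟩ := exists_bound_of_countable hJ fun o : Option P => o.elim i k
  let ψ : i ⟶ j := homOfLE (hj none)
  have hψ : ∀ x ∈ W, ∀ y ∈ W, c.ι.app i x = c.ι.app i y → F.map ψ x = F.map ψ y := by
    intro x hx y hy hxy
    let p : P := ⟨(⟨x, hx⟩, ⟨y, hy⟩), hxy⟩
    have e : ψ = φ p ≫ homOfLE (hj (some p)) := rfl
    rw [e, F.map_comp]
    exact congrArg (F.map (homOfLE (hj (some p)))) (hφ p)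
  have hι : ∀ x, c.ι.app j (F.map ψ x) = c.ι.app i x := fun x =>
    ConcreteCategory.congr_hom (c.w ψ) x
  -- At stage `j` the image of the two supports injects into the colimit, so the coefficients of the
  -- direct images can be compared there.
  let V : Set (F.obj j) := F.map ψ '' W
  have hV : ∀ b : Formal R (F.obj i), Function.support b.1 ⊆ W →
      Function.support (map (F.map ψ) b).1 ⊆ Set.range (Subtype.val : V → F.obj j) := by
    intro b hb
    rw [Subtype.range_coe]
    exact (support_map _ b).trans (Set.image_mono hb)
  obtain ⟨b, hb, -⟩ := map_comp_of_injective (f := (Subtype.val : V → F.obj j))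
    Subtype.val_injective _ (hV a Set.subset_union_left)
  obtain ⟨b', hb', -⟩ := map_comp_of_injective (f := (Subtype.val : V → F.obj j))
    Subtype.val_injective _ (hV a' Set.subset_union_right)
  refine ⟨j, ψ, ?_⟩
  have hinj : Function.Injective fun v : V => c.ι.app j v.1 := by
    rintro ⟨_, x, hx, rfl⟩ ⟨_, y, hy, rfl⟩ hxy
    refine Subtype.ext (hψ x hx y hy ?_)
    rw [← hι, ← hι]
    exact hxy
  have hbb : map (fun v : V => c.ι.app j v.1) b = map (fun v : V => c.ι.app j v.1) b' := by
    rw [← map_map (Subtype.val : V → F.obj j), ← map_map (Subtype.val : V → F.obj j), hb, hb',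
      map_map, map_map, funext hι, h]
  rw [← hb, ← hb']
  congr 1
  refine Formal.ext fun v => ?_
  rw [← map_apply_of_injective hinj b, ← map_apply_of_injective hinj b', hbb]

variable (R) in
/-- The monad `X ↦ R[[X]]` preserves countably directed colimits. -/
theorem monad_preservesColimitsOfShape (hJ : ∀ s : ℕ → J, ∃ j, ∀ n, s n ≤ j) :
    PreservesColimitsOfShape J (monad R).toFunctor where
  preservesColimit {F} := ⟨fun {c} hc => by
    have := isDirected_of_bounded_sequences hJ
    refine ⟨Types.FilteredColimit.isColimitOf' _ _ (fun b => ?_) fun i a a' h => ?_⟩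
    · exact exists_map_eq hJ hc b
    · exact exists_map_eq_map hJ hc a a' h⟩

variable (R) in
/-- Countably directed colimits of contramodules are computed on the underlying sets. -/
theorem forget_preservesColimitsOfShape (hJ : ∀ s : ℕ → J, ∃ j, ∀ n, s n ≤ j) :
    PreservesColimitsOfShape J (monad R).forget := by
  have := monad_preservesColimitsOfShape R hJ
  infer_instance

/-- A contramodule is small with respect to sufficiently directed colimits. -/
theorem exists_factorization_of_isColimit {κ : Cardinal.{u}} (hκ : Cardinal.aleph0 < κ)
    (hJ : ∀ (K : Type u) (s : K → J), Cardinal.mk K < κ → ∃ j, ∀ k, s k ≤ j)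
    (A : Contra R) (hA : Cardinal.mk A.A < κ) (hA' : Cardinal.mk (Formal R A.A) < κ)
    {D : J ⥤ Contra R} {c : Cocone D} (hc : IsColimit c) (f : A ⟶ c.pt) :
    ∃ (j : J) (g : A ⟶ D.obj j), g ≫ c.ι.app j = f := by
  have hJ' : ∀ s : ℕ → J, ∃ j, ∀ n, s n ≤ j := fun s => by
    obtain ⟨j, hj⟩ := hJ (ULift ℕ) (fun n => s n.down) (by simpa using hκ)
    exact ⟨j, fun n => hj ⟨n⟩⟩
  have := isDirected_of_bounded_sequences hJ'
  have := forget_preservesColimitsOfShape R hJ'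
  have hc' := isColimitOfPreserves (monad R).forget hc
  have h : ∀ a : A.A, ∃ (j : J) (x : (D.obj j).A), (c.ι.app j).f x = f.f a := fun a =>
    Types.jointly_surjective_of_isColimit hc' (f.f a)
  choose i x hx using h
  obtain ⟨j, hj⟩ := hJ _ i hA
  let g : A.A → (D.obj j).A := fun a => (D.map (homOfLE (hj a))).f (x a)
  have hg : ∀ a, (c.ι.app j).f (g a) = f.f a := fun a =>
    (hom_congr (c.w (homOfLE (hj a))) (x a)).trans (hx a)
  -- The map `g` need not be a morphism. For each `t` its compatibility with the contraaction holds
  -- in the colimit, hence at a later stage; there are fewer than `κ` such `t`, so one stage serves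
  -- for all.
  have ht : ∀ t : Formal R A.A, ∃ (k : J) (φ : j ⟶ k),
      (D.map φ).f (act (D.obj j) (map g t)) = (D.map φ).f (g (act A t)) := fun t => by
    refine (Types.FilteredColimit.isColimit_eq_iff' hc' (i := j) _ _).1 ?_
    change (c.ι.app j).f (act (D.obj j) (map g t)) = (c.ι.app j).f (g (act A t))
    rw [hg, ← act_map_hom, ← act_map_hom, map_map, funext hg]
    rfl
  choose k φ hφ using ht
  obtain ⟨l, hl⟩ := hJ _ k hA'
  -- The combination `0` only supplies some arrow `j ⟶ l`; in a preorder all such arrows agree.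
  let ψ : j ⟶ l := φ 0 ≫ homOfLE (hl 0)
  refine ⟨l, homMk (fun a => (D.map ψ).f (g a)) fun t => ?_, contraHom_ext fun a => ?_⟩
  · have e : ψ = φ t ≫ homOfLE (hl t) := rfl
    rw [← map_map g, act_map_hom, e, D.map_comp]
    exact congrArg (D.map (homOfLE (hl t))).f (hφ t)
  · exact (hom_congr (c.w ψ) (g a)).trans (hg a)

end FilteredColimits

end Contramodule

/-! ### The small object argument with one cell per step. -/

namespace CellularFactorization

set_option linter.unusedSectionVars false

variable {K : Type v} [Category.{u} K] {ι : Type u} {A B : ι → K} (i : ∀ s, A s ⟶ B s) {Z : K}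

/-- A lifting problem of a morphism to `Z` with respect to the family of morphisms `i`. -/
structure Problem (Y : Over Z) where
  /-- The index of the left side. -/
  idx : ι
  /-- The top side. -/
  top : A idx ⟶ Y.left
  /-- The bottom side. -/
  bot : B idx ⟶ Z
  w : top ≫ Y.hom = i idx ≫ bot

variable {i}

/-- A lifting problem is solved if it has a lift. -/
def Problem.Solved {Y : Over Z} (p : Problem i Y) : Prop :=
  ∃ l : B p.idx ⟶ Y.left, i p.idx ≫ l = p.top ∧ l ≫ Y.hom = p.bot

/-- The image of a lifting problem under a morphism over `Z`. -/
@[simps]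
def Problem.map {Y Y' : Over Z} (φ : Y ⟶ Y') (p : Problem i Y) : Problem i Y' where
  idx := p.idx
  top := p.top ≫ φ.left
  bot := p.bot
  w := by rw [Category.assoc, Over.w, p.w]

theorem Problem.Solved.map {Y Y' : Over Z} (φ : Y ⟶ Y') {p : Problem i Y} (h : p.Solved) :
    (p.map φ).Solved := by
  obtain ⟨l, h₁, h₂⟩ := h
  have h₁' : i p.idx ≫ l ≫ φ.left = p.top ≫ φ.left := by rw [← Category.assoc, h₁]
  have h₂' : (l ≫ φ.left) ≫ Y'.hom = p.bot := by rw [Category.assoc, Over.w, h₂]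
  exact ⟨l ≫ φ.left, h₁', h₂'⟩

variable (i Z) in
/-- The functor of lifting problems. -/
@[simps]
def problemFunctor : Over Z ⥤ Type u where
  obj Y := Problem i Y
  map φ := ↾(Problem.map φ)
  map_id Y := ConcreteCategory.hom_ext _ _ fun p => by
    cases p
    simp [Problem.map]
  map_comp φ ψ := ConcreteCategory.hom_ext _ _ fun p => by
    simp [Problem.map]

/-- A factorization of a morphism to `Z` in progress: an object over `Z` together with a set of
lifting problems to be solved next. -/
abbrev State (i : ∀ s, A s ⟶ B s) (Z : K) := Comma (𝟭 (Type u)) (problemFunctor i Z)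

/-- A scheduled lifting problem of a state. -/
def State.problem (S : State i Z) (t : S.left) : Problem i S.right := S.hom t

theorem State.problem_map {S S' : State i Z} (f : S ⟶ S') (t : S.left) :
    S'.problem (f.left t) = (S.problem t).map f.right :=
  ConcreteCategory.congr_hom f.w t

variable [HasPushouts K]

/-- The object over `Z` obtained by attaching a cell that solves a lifting problem. -/
def attach {Y : Over Z} (p : Problem i Y) : Over Z :=
  Over.mk (pushout.desc Y.hom p.bot p.w : pushout p.top (i p.idx) ⟶ Z)

/-- The inclusion to the object with a cell attached. -/
def toAttach {Y : Over Z} (p : Problem i Y) : Y ⟶ attach p :=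
  Over.homMk (pushout.inl p.top (i p.idx)) (pushout.inl_desc _ _ _)

theorem solved_map_toAttach {Y : Over Z} (p : Problem i Y) : (p.map (toAttach p)).Solved :=
  ⟨pushout.inr p.top (i p.idx), pushout.condition.symm, pushout.inr_desc _ _ _⟩

/-- The scheduling rule: while some scheduled problem is unsolved, keep the list and attack such a
problem; otherwise replace the list by all current problems and attach an arbitrary cell, which `h₀`
provides. -/
theorem exists_schedule (h₀ : ∀ Y : Over Z, Nonempty (Problem i Y)) (S : State i Z) :
    ∃ (T : Type u) (a : S.left ⟶ T) (b : T ⟶ (problemFunctor i Z).obj S.right)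
      (p : Problem i S.right), a ≫ b = S.hom ∧ (T = S.left ∨ T = Problem i S.right) ∧
        ((∃ t, ¬ (S.problem t).Solved) →
          Function.Surjective a ∧ ∃ t, S.problem t = p ∧ ¬ p.Solved) ∧
        ((∀ t, (S.problem t).Solved) → Function.Surjective b) := by
  by_cases h : ∃ t, ¬ (S.problem t).Solved
  · obtain ⟨t, ht⟩ := h
    exact ⟨S.left, 𝟙 _, S.hom, S.problem t, rfl, Or.inl rfl,
      fun _ => ⟨fun x => ⟨x, rfl⟩, t, rfl, ht⟩, fun h => absurd (h t) ht⟩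
  · obtain ⟨p⟩ := h₀ S.right
    exact ⟨Problem i S.right, S.hom, 𝟙 _, p, rfl, Or.inr rfl, fun h' => absurd h' h,
      fun _ x => ⟨x, rfl⟩⟩

/-- The morphisms of states that attach a cell, with the properties that are needed in order to
show that all lifting problems are eventually solved. -/
def attachCell : MorphismProperty (State i Z) := fun S S' f =>
  (∃ (s : ι) (a : A s ⟶ S.right.left) (b : B s ⟶ S'.right.left),
    IsPushout a (i s) f.right.left b) ∧
  (S'.left = S.left ∨ S'.left = Problem i S.right) ∧
  ((∃ t, ¬ (S.problem t).Solved) → Function.Surjective f.left ∧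
    ∃ t, ¬ (S.problem t).Solved ∧ ((S.problem t).map f.right).Solved) ∧
  ((∀ t, (S.problem t).Solved) → ∀ q : Problem i S.right, ∃ t, S'.problem t = q.map f.right)

theorem exists_attachCell (h₀ : ∀ Y : Over Z, Nonempty (Problem i Y)) (S : State i Z) :
    ∃ (S' : State i Z) (f : S ⟶ S'), attachCell f := by
  obtain ⟨T, a, b, p, hab, hT, h₁, h₂⟩ := exists_schedule h₀ S
  let S' : State i Z :=
    { left := T
      right := attach p
      hom := b ≫ (problemFunctor i Z).map (toAttach p) }
  refine ⟨S', { left := a, right := toAttach p, w := ?_ }, ⟨p.idx, p.top, pushout.inr _ _,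
    IsPushout.of_hasPushout _ _⟩, hT, fun h => ⟨(h₁ h).1, ?_⟩, fun h q => ?_⟩
  · change a ≫ b ≫ _ = S.hom ≫ _
    rw [← hab, Category.assoc]
  · obtain ⟨t, rfl, ht⟩ := (h₁ h).2
    exact ⟨t, ht, solved_map_toAttach _⟩
  · obtain ⟨t, rfl⟩ := h₂ h q
    exact ⟨t, rfl⟩

/-- The successor structure on states, starting from an object over `Z`. -/
def succStruct (h₀ : ∀ Y : Over Z, Nonempty (Problem i Y)) (Y : Over Z) :
    SmallObject.SuccStruct (State i Z) where
  X₀ := { left := Problem i Y, right := Y, hom := 𝟙 _ }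
  succ S := (exists_attachCell h₀ S).choose
  toSucc S := (exists_attachCell h₀ S).choose_spec.choose

theorem succStruct_prop_le (h₀ : ∀ Y : Over Z, Nonempty (Problem i Y)) (Y : Over Z) :
    (succStruct h₀ Y).prop ≤ attachCell := by
  rintro S S' f ⟨_⟩
  exact (exists_attachCell h₀ S).choose_spec.choose_spec

/-- The lengths of the transfinite iterations used in the small object argument. -/
structure IsLong (J : Type u) [LinearOrder J] [OrderTop J] (κ : Cardinal.{u}) : Prop where
  isSuccLimit_top : Order.IsSuccLimit (⊤ : J)
  exists_bound (T : Type u) (s : T → Set.Iio (⊤ : J)) (hT : Cardinal.mk T < κ) :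
    ∃ j, ∀ t, s t ≤ j
  card_lt (j : J) (hj : j < ⊤) : Cardinal.mk (Set.Iio j) < κ

/-! ### Bookkeeping along a chain of states. -/

section Chains

variable {J : Type u} [LinearOrder J] [OrderBot J] [OrderTop J] [SuccOrder J] [WellFoundedLT J]
  {κ : Cardinal.{u}}

theorem IsLong.succ_lt (hJ : IsLong J κ) {j : J} (hj : j < ⊤) : Order.succ j < ⊤ :=
  hJ.isSuccLimit_top.succ_lt hj

variable [HasColimitsOfSize.{u, u} K] {D : J ⥤ State i Z} [D.IsWellOrderContinuous]
  (hD : ∀ j < ⊤, attachCell (D.map (homOfLE (Order.le_succ j))))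

theorem problem_map_map {j k l : J} (hjk : j ≤ k) (hkl : k ≤ l) (p : Problem i (D.obj j).right) :
    (p.map (D.map (homOfLE hjk)).right).map (D.map (homOfLE hkl)).right =
      p.map (D.map (homOfLE (hjk.trans hkl))).right := by
  have h : D.map (homOfLE (hjk.trans hkl)) = D.map (homOfLE hjk) ≫ D.map (homOfLE hkl) := by
    rw [← D.map_comp]
    rfl
  rw [h]
  exact (ConcreteCategory.congr_hom ((problemFunctor i Z).map_comp (D.map (homOfLE hjk)).right
    (D.map (homOfLE hkl)).right) p).symm

theorem left_map_map {j k l : J} (hjk : j ≤ k) (hkl : k ≤ l) (t : (D.obj j).left) :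
    (D.map (homOfLE hkl)).left ((D.map (homOfLE hjk)).left t) =
      (D.map (homOfLE (hjk.trans hkl))).left t := by
  have h : D.map (homOfLE (hjk.trans hkl)) = D.map (homOfLE hjk) ≫ D.map (homOfLE hkl) := by
    rw [← D.map_comp]
    rfl
  rw [h]
  rfl

/-- The projection of the comma category to sets preserves colimits, so no problem is newly
scheduled at a limit stage. -/
theorem exists_left_of_isSuccLimit {k : J} (hk : Order.IsSuccLimit k) (t : (D.obj k).left) :
    ∃ (j : J) (hj : j < k) (x : (D.obj j).left), (D.map (homOfLE hj.le)).left x = t := by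
  have hc := isColimitOfPreserves (Comma.fst _ _) (D.isColimitOfIsWellOrderContinuous k hk)
  obtain ⟨j, x, hx⟩ := Types.jointly_surjective_of_isColimit hc t
  exact ⟨j.1, j.2, x, hx⟩

include hD

/-- As long as there are unsolved scheduled problems, no new problems are scheduled. -/
theorem left_surjective_of_unsolved {j : J}
    (h : ∀ k < ⊤, j ≤ k → ∃ t, ¬ ((D.obj k).problem t).Solved) (k : J) (hk : k < ⊤)
    (hjk : j ≤ k) : Function.Surjective (D.map (homOfLE hjk)).left := by
  induction k using SuccOrder.limitRecOn with
  | isMin k hmin =>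
    obtain rfl := le_antisymm hjk (hmin hjk)
    intro t
    exact ⟨t, ConcreteCategory.congr_hom (congrArg CommaMorphism.left (D.map_id j)) t⟩
  | succ k hmax ih =>
    rcases eq_or_lt_of_le hjk with rfl | hlt
    · intro t
      exact ⟨t, ConcreteCategory.congr_hom (congrArg CommaMorphism.left (D.map_id _)) t⟩
    · have hjk' := (Order.lt_succ_iff_of_not_isMax hmax).1 hlt
      have hk' := lt_of_le_of_lt (Order.le_succ k) hk
      intro t
      obtain ⟨t, rfl⟩ := ((hD k hk').2.2.1 (h k hk' hjk')).1 t
      obtain ⟨t, rfl⟩ := ih hk' hjk' t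
      exact ⟨t, (left_map_map hjk' (Order.le_succ k) t).symm⟩
  | isSuccLimit k hlim ih =>
    rcases eq_or_lt_of_le hjk with rfl | hlt
    · intro t
      exact ⟨t, ConcreteCategory.congr_hom (congrArg CommaMorphism.left (D.map_id _)) t⟩
    · intro t
      obtain ⟨l, hl, x, rfl⟩ := exists_left_of_isSuccLimit hlim t
      -- The stage `l` may precede `j`, so the element is first moved to `max j l`.
      have hm : max j l < k := max_lt hlt hl
      obtain ⟨y, hy⟩ := ih _ hm (hm.trans hk) (le_max_left _ _)
        ((D.map (homOfLE (le_max_right j l))).left x)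
      refine ⟨y, ?_⟩
      rw [← left_map_map (le_max_left j l) hm.le, hy, left_map_map]

/-- All scheduled problems are eventually solved. -/
theorem exists_forall_solved (hJ : IsLong J κ)
    (hT : ∀ j < ⊤, Cardinal.mk (D.obj j).left < κ) (j : J) (hj : j < ⊤) :
    ∃ k < ⊤, j ≤ k ∧ ∀ t, ((D.obj k).problem t).Solved := by
  by_contra! hcon
  have hs := left_surjective_of_unsolved hD hcon
  -- At every stage `k` from `j` on, some problem passes from unsolved to solved, and by
  -- surjectivity it stems from the list at stage `j`. Solved problems stay solved, so distinct
  -- stages give distinct elements of that list, which has fewer than `κ` elements; hence the stages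
  -- from `j` on would be bounded below `⊤`.
  have h : ∀ k : Set.Ico j ⊤, ∃ x : (D.obj j).left,
      ¬ (((D.obj j).problem x).map (D.map (homOfLE k.2.1)).right).Solved ∧
      (((D.obj j).problem x).map
        (D.map (homOfLE (k.2.1.trans (Order.le_succ k.1)))).right).Solved := by
    rintro ⟨k, hk₁, hk₂⟩
    obtain ⟨t, ht₁, ht₂⟩ := ((hD k hk₂).2.2.1 (hcon k hk₂ hk₁)).2
    obtain ⟨x, rfl⟩ := hs k hk₂ hk₁ t
    rw [State.problem_map] at ht₁ ht₂
    rw [problem_map_map] at ht₂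
    exact ⟨x, ht₁, ht₂⟩
  choose x hx₁ hx₂ using h
  have hne : ∀ k l : Set.Ico j ⊤, k < l → x k ≠ x l := by
    intro k l hkl e
    refine hx₁ l ?_
    rw [← e, ← problem_map_map (k.2.1.trans (Order.le_succ k.1)) (Order.succ_le_of_lt hkl)]
    exact (hx₂ k).map _
  have hinj : Function.Injective x := fun k l e => by
    rcases lt_trichotomy k l with hkl | hkl | hkl
    · exact absurd e (hne k l hkl)
    · exact hkl
    · exact absurd e.symm (hne l k hkl)
  obtain ⟨⟨m, hm⟩, hm'⟩ := hJ.exists_bound (Set.Ico j ⊤) (fun k => ⟨k.1, k.2.2⟩)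
    ((Cardinal.mk_le_of_injective hinj).trans_lt (hT j hj))
  -- Taking the maximum with `j` keeps the stage that violates the bound `m` within the interval.
  have hlt := hJ.succ_lt (max_lt hm hj)
  have h₁ := hm' ⟨Order.succ (max m j), (le_max_right m j).trans (Order.le_succ _), hlt⟩
  have h₂ : Order.succ (max m j) ≤ m := h₁
  exact absurd (Order.lt_succ_of_not_isMax (not_isMax_of_lt (max_lt hm hj)))
    (not_lt.2 (h₂.trans (le_max_left _ _)))

/-- All lifting problems are eventually solved. -/
theorem exists_solved (hJ : IsLong J κ)
    (hT : ∀ j < ⊤, Cardinal.mk (D.obj j).left < κ) (j : J) (hj : j < ⊤)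
    (p : Problem i (D.obj j).right) :
    ∃ (k : J) (_ : k < ⊤) (hjk : j ≤ k), (p.map (D.map (homOfLE hjk)).right).Solved := by
  -- Once the list is exhausted at `k`, all current problems, the image of `p` among them, are
  -- scheduled at `succ k`; exhausting the list again solves `p`.
  obtain ⟨k, hk, hjk, hs⟩ := exists_forall_solved hD hJ hT j hj
  obtain ⟨l, hl, hkl, hs'⟩ := exists_forall_solved hD hJ hT _ (hJ.succ_lt hk)
  refine ⟨l, hl, (hjk.trans (Order.le_succ k)).trans hkl, ?_⟩
  obtain ⟨t, ht⟩ := (hD k hk).2.2.2 hs (p.map (D.map (homOfLE hjk)).right)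
  have h := hs' ((D.map (homOfLE hkl)).left t)
  rwa [State.problem_map, ht, problem_map_map, problem_map_map] at h

/-- By smallness of `A s`, the top side of a square factors through a stage before `⊤`. There the
square is a lifting problem, which a later stage solves, and the solution is pushed forward to `⊤`.
-/
theorem hasLiftingProperty_top (hJ : IsLong J κ)
    (hT : ∀ j < ⊤, Cardinal.mk (D.obj j).left < κ)
    (hsmall : ∀ (E : Set.Iio (⊤ : J) ⥤ K) (c : Cocone E), IsColimit c → ∀ (s : ι)
      (f : A s ⟶ c.pt), ∃ (j : _) (g : A s ⟶ E.obj j), g ≫ c.ι.app j = f) (s : ι) :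
    HasLiftingProperty (i s) (D.obj ⊤).right.hom where
  sq_hasLift {f g} sq := by
    have hc := isColimitOfPreserves (Comma.snd _ _ ⋙ Over.forget Z)
      (D.isColimitOfIsWellOrderContinuous ⊤ hJ.isSuccLimit_top)
    obtain ⟨⟨j, hj⟩, (a : A s ⟶ (D.obj j).right.left), ha⟩ := hsmall _ _ hc s f
    have ha' : a ≫ (D.map (homOfLE le_top)).right.left = f := ha
    have hj' : j < ⊤ := hj
    let p : Problem i (D.obj j).right :=
      { idx := s
        top := a
        bot := g
        w := by rw [← sq.w, ← ha', Category.assoc, Over.w] }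
    obtain ⟨k, hk, hjk, hs⟩ := exists_solved hD hJ hT j hj' p
    have h := hs.map (D.map (homOfLE (le_top (a := k)))).right
    rw [problem_map_map] at h
    obtain ⟨l, h₁, h₂⟩ := h
    exact ⟨⟨⟨l, h₁.trans ha', h₂⟩⟩⟩

/-- The terms of the chain belong to any class of objects closed under attaching cells and
under short colimits; the sets of scheduled problems are small. -/
theorem mem_and_card_lt (hJ : IsLong J κ) (hκ : κ.IsRegular) {Q : ObjectProperty K}
    [Q.IsClosedUnderIsomorphisms] (hQ₀ : Q (D.obj ⊥).right.left)
    (hT₀ : Cardinal.mk (D.obj ⊥).left < κ)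
    (hQ₁ : ∀ {s : ι} {X Y : K} {a : A s ⟶ X} {f : X ⟶ Y} {b : B s ⟶ Y},
      IsPushout a (i s) f b → Q X → Q Y)
    (hQ₂ : ∀ j : J, j < ⊤ → ∀ (E : Set.Iio j ⥤ K) (c : Cocone E), IsColimit c →
      (∀ k, Q (E.obj k)) → Q c.pt)
    (hQ₃ : ∀ Y : Over Z, Q Y.left → Cardinal.mk (Problem i Y) < κ) (j : J) (hj : j < ⊤) :
    Q (D.obj j).right.left ∧ Cardinal.mk (D.obj j).left < κ := by
  induction j using SuccOrder.limitRecOn with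
  | isMin j hmin =>
    obtain rfl := hmin.eq_bot
    exact ⟨hQ₀, hT₀⟩
  | succ j hmax ih =>
    have hj' := lt_of_le_of_lt (Order.le_succ j) hj
    obtain ⟨⟨s, a, b, hp⟩, hT, -⟩ := hD j hj'
    refine ⟨hQ₁ hp (ih hj').1, ?_⟩
    rcases hT with hT | hT
    · rw [hT]
      exact (ih hj').2
    · rw [hT]
      exact hQ₃ _ (ih hj').1
  | isSuccLimit j hlim ih =>
    have hc := isColimitOfPreserves (Comma.snd _ _ ⋙ Over.forget Z)
      (D.isColimitOfIsWellOrderContinuous j hlim)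
    refine ⟨hQ₂ j hj _ _ hc fun k => (ih k.1 k.2 (lt_trans k.2 hj)).1, ?_⟩
    have hs : Function.Surjective fun x : Σ k : Set.Iio j, (D.obj k.1).left =>
        (D.map (homOfLE x.1.2.le)).left x.2 := fun t => by
      obtain ⟨k, hk, x, hx⟩ := exists_left_of_isSuccLimit hlim t
      exact ⟨⟨⟨k, hk⟩, x⟩, hx⟩
    refine (Cardinal.mk_le_of_surjective hs).trans_lt ?_
    rw [Cardinal.mk_sigma]
    exact Cardinal.sum_lt_of_isRegular hκ (hJ.card_lt j hj) fun k =>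
      (ih k.1 k.2 (lt_trans k.2 hj)).2

end Chains

/-- The small object argument with the cells attached one by one. -/
theorem exists_factorization {J : Type u} [LinearOrder J] [OrderBot J] [OrderTop J] [SuccOrder J]
    [WellFoundedLT J] {κ : Cardinal.{u}} (hJ : IsLong J κ) (hκ : κ.IsRegular)
    [HasColimitsOfSize.{u, u} K] (h₀ : ∀ Y : Over Z, Nonempty (Problem i Y))
    {Q : ObjectProperty K} [Q.IsClosedUnderIsomorphisms]
    (hQ₁ : ∀ {s : ι} {X Y : K} {a : A s ⟶ X} {f : X ⟶ Y} {b : B s ⟶ Y},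
      IsPushout a (i s) f b → Q X → Q Y)
    (hQ₂ : ∀ j : J, j < ⊤ → ∀ (E : Set.Iio j ⥤ K) (c : Cocone E), IsColimit c →
      (∀ k, Q (E.obj k)) → Q c.pt)
    (hQ₃ : ∀ Y : Over Z, Q Y.left → Cardinal.mk (Problem i Y) < κ)
    (hsmall : ∀ (E : Set.Iio (⊤ : J) ⥤ K) (c : Cocone E), IsColimit c → ∀ (s : ι)
      (f : A s ⟶ c.pt), ∃ (j : _) (g : A s ⟶ E.obj j), g ≫ c.ι.app j = f)
    {X : K} (hX : Q X) (f : X ⟶ Z) :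
    ∃ (D : J ⥤ K) (e : D.obj ⊥ ≅ X) (p : D.obj ⊤ ⟶ Z), D.IsWellOrderContinuous ∧
      D.map (homOfLE bot_le) ≫ p = e.hom ≫ f ∧
      (∀ j < ⊤, ∃ (s : ι) (a : A s ⟶ D.obj j) (b : B s ⟶ D.obj (Order.succ j)),
        IsPushout a (i s) (D.map (homOfLE (Order.le_succ j))) b) ∧
      ∀ s, HasLiftingProperty (i s) p := by
  let Φ := succStruct h₀ (Over.mk f)
  let D := Φ.iterationFunctor J
  have hD : ∀ j < ⊤, attachCell (D.map (homOfLE (Order.le_succ j))) := fun j hj =>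
    succStruct_prop_le h₀ _ _ (Φ.prop_iterationFunctor_map_succ j (not_isMax_of_lt hj))
  let e₀ : D.obj ⊥ ≅ Φ.X₀ := Φ.iterationFunctorObjBotIso J
  let e : (D.obj ⊥).right ≅ Over.mk f := (Comma.snd _ _).mapIso e₀
  have hQ₀ : Q (D.obj ⊥).right.left := Q.prop_of_iso ((Over.forget Z).mapIso e).symm hX
  have hT₀ : Cardinal.mk (D.obj ⊥).left < κ := by
    have h : (D.obj ⊥).left ≃ Problem i (Over.mk f) := ((Comma.fst _ _).mapIso e₀).toEquiv
    rw [Cardinal.mk_congr h]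
    exact hQ₃ (Over.mk f) hX
  have hQ := mem_and_card_lt hD hJ hκ hQ₀ hT₀ hQ₁ hQ₂ hQ₃
  refine ⟨D ⋙ Comma.snd _ _ ⋙ Over.forget Z, (Over.forget Z).mapIso e, (D.obj ⊤).right.hom,
    ⟨fun m hm => ⟨isColimitOfPreserves (Comma.snd _ _ ⋙ Over.forget Z)
      (D.isColimitOfIsWellOrderContinuous m hm)⟩⟩, ?_, fun j hj => (hD j hj).1,
    hasLiftingProperty_top hD hJ (fun j hj => (hQ j hj).2) hsmall⟩
  exact (Over.w (D.map (homOfLE bot_le)).right).trans (Over.w e.hom).symm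

end CellularFactorization

/-! ### Existence of long well-orders. -/

namespace CellularFactorization

/-- The ordinals up to a regular cardinal form a long well-order. -/
theorem exists_isLong {κ : Cardinal.{u}} (hκ : κ.IsRegular) :
    ∃ (J : Type u) (_ : LinearOrder J) (_ : OrderBot J) (_ : OrderTop J) (_ : SuccOrder J)
      (_ : WellFoundedLT J), IsLong J κ := by
  classical
  have : Fact κ.IsRegular := ⟨hκ⟩
  have := Cardinal.noMaxOrder hκ.aleph0_le
  have : Nonempty κ.ord.ToType := by
    rw [← Cardinal.mk_ne_zero_iff, Cardinal.mk_ord_toType]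
    exact hκ.pos.ne'
  let _ : OrderBot κ.ord.ToType := WellFoundedLT.toOrderBot _
  let _ : SuccOrder κ.ord.ToType := SuccOrder.ofLinearWellFoundedLT _
  refine ⟨WithTop κ.ord.ToType, inferInstance, inferInstance, inferInstance, inferInstance,
    inferInstance, ⟨?_, fun T s hT => ?_, fun j hj => ?_⟩⟩
  · refine ⟨not_isMin_top, fun a ha => ?_⟩
    obtain ⟨a, rfl⟩ := WithTop.ne_top_iff_exists.1 ha.lt.ne
    obtain ⟨b, hb⟩ := exists_gt a
    exact ha.2 (WithTop.coe_lt_coe.2 hb) (WithTop.coe_lt_top b)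
  · have h : ∀ t, ∃ a : κ.ord.ToType, (a : WithTop κ.ord.ToType) = (s t).1 := fun t =>
      WithTop.ne_top_iff_exists.1 (s t).2.ne
    choose a ha using h
    have hT' : HasCardinalLT T κ := by rwa [hasCardinalLT_iff_cardinal_mk_lt]
    refine ⟨⟨_, WithTop.coe_lt_top (IsCardinalFiltered.max a hT')⟩, fun t => ?_⟩
    change (s t).1 ≤ _
    rw [← ha]
    exact WithTop.coe_le_coe.2 (leOfHom (IsCardinalFiltered.toMax a hT' t))
  · obtain ⟨a, rfl⟩ := WithTop.ne_top_iff_exists.1 hj.ne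
    refine lt_of_le_of_lt ?_ ((Cardinal.mk_Iio_lt a (by simp)).trans_eq (Cardinal.mk_ord_toType κ))
    refine Cardinal.mk_le_of_surjective (f := fun b : Set.Iio a =>
      (⟨(b.1 : WithTop κ.ord.ToType), WithTop.coe_lt_coe.2 b.2⟩ : Set.Iio _)) ?_
    rintro ⟨b, hb⟩
    obtain ⟨b, rfl⟩ := WithTop.ne_top_iff_exists.1
      (show b < (a : WithTop κ.ord.ToType) from hb).ne_top
    exact ⟨⟨b, WithTop.coe_lt_coe.1 hb⟩, rfl⟩

end CellularFactorization

namespace Contramodule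

open Cardinal

/-! ### Cardinality bounds for contramodules. -/

section Cardinality

variable {R : Type u} [Ring R] [UniformSpace R] [IsUniformAddGroup R] [IsTopologicalRing R]
  [IsLinearTopology Rᵐᵒᵖ R] [CompleteSpace R] [T2Space R]

/-- A formal combination is determined by its graph over its support, a countable subset of `X × R`.
-/
theorem mk_formal_le [(𝓝 (0 : R)).IsCountablyGenerated] {X : Type u} {μ : Cardinal.{u}}
    (hμ : μ ^ ℵ₀ = μ) (hμ' : ℵ₀ ≤ μ) (hR : #R ≤ μ) (hX : #X ≤ μ) : #(Formal R X) ≤ μ := by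
  let g : Formal R X → {t : Set (X × R) // #t ≤ ℵ₀} := fun a =>
    ⟨(fun x => (x, a.1 x)) '' Function.support a.1,
      mk_image_le.trans (Cardinal.le_aleph0_iff_set_countable.2 (countable_support a))⟩
  have hg : Function.Injective g := fun a b h => Formal.ext fun x => by
    have h' : (fun x => (x, a.1 x)) '' Function.support a.1 =
      (fun x => (x, b.1 x)) '' Function.support b.1 := congrArg Subtype.val h
    by_contra hne
    by_cases hx : a.1 x = 0
    · have hm : (x, b.1 x) ∈ (fun x => (x, a.1 x)) '' Function.support a.1 := by
        rw [h']
        exact ⟨x, fun h0 => hne (hx.trans h0.symm), rfl⟩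
      obtain ⟨y, hy, hxy⟩ := hm
      obtain ⟨rfl, hxy⟩ := Prod.mk.inj hxy
      exact hne hxy
    · have hm : (x, a.1 x) ∈ (fun x => (x, b.1 x)) '' Function.support b.1 := by
        rw [← h']
        exact ⟨x, hx, rfl⟩
      obtain ⟨y, hy, hxy⟩ := hm
      obtain ⟨rfl, hxy⟩ := Prod.mk.inj hxy
      exact hne hxy.symm
  refine (mk_le_of_injective hg).trans ((mk_bounded_set_le _ _).trans ?_)
  have hXR : #(X × R) ≤ μ := by
    rw [mk_prod, lift_id, lift_id]
    exact mul_le_of_le hμ' hX hR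
  exact (power_le_power_right (max_le hXR hμ')).trans hμ.le

theorem mk_hom_le {A Y : Contra R} {μ ν : Cardinal.{u}} (hμ : μ ^ ν = μ) (hμ₀ : μ ≠ 0)
    (hA : #A.A ≤ ν) (hY : #Y.A ≤ μ) : #(A ⟶ Y) ≤ μ := by
  have h : Function.Injective fun (f : A ⟶ Y) (a : A.A) => f.f a := fun f g h =>
    contraHom_ext fun p => congrFun h p
  refine (mk_le_of_injective h).trans ?_
  rw [mk_arrow, lift_id, lift_id]
  exact ((power_le_power_right hY).trans (power_le_power_left hμ₀ hA)).trans hμ.le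

/-- The pushout is a quotient of `X ⊞ B`, and epimorphisms of contramodules are surjective. -/
theorem mk_pushout_le {A B X Y : Contra R} {a : A ⟶ X} {i : A ⟶ B} {f : X ⟶ Y} {b : B ⟶ Y}
    (h : IsPushout a i f b) {μ : Cardinal.{u}} (hμ : ℵ₀ ≤ μ) (hX : #X.A ≤ μ) (hB : #B.A ≤ μ) :
    #Y.A ≤ μ := by
  have : Epi (biprod.desc f b) := by
    refine ⟨fun u v huv => h.hom_ext ?_ ?_⟩
    · simpa using congrArg (biprod.inl ≫ ·) huv
    · simpa using congrArg (biprod.inr ≫ ·) huv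
  have hs := (epi_iff _).1 this
  have hs' : Function.Surjective fun p : X.A × B.A => f.f p.1 + b.f p.2 := fun y => by
    obtain ⟨z, rfl⟩ := hs y
    refine ⟨((biprod.fst : X ⊞ B ⟶ X).f z, (biprod.snd : X ⊞ B ⟶ B).f z), ?_⟩
    exact (hom_congr (biprod.desc_eq (f := f) (g := b)) z).symm
  refine (mk_le_of_surjective hs').trans ?_
  rw [mk_prod, lift_id, lift_id]
  exact mul_le_of_le hμ hX hB

/-- The colimit is a quotient of the free contramodule on the disjoint union of the terms. No
directedness is needed, so this also covers limit stages of countable cofinality. -/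
theorem mk_colimit_le [(𝓝 (0 : R)).IsCountablyGenerated] {J : Type u} [Category.{u} J]
    {D : J ⥤ Contra R} {c : Cocone D} (hc : IsColimit c) {μ : Cardinal.{u}} (hμ : μ ^ ℵ₀ = μ)
    (hμ' : ℵ₀ ≤ μ) (hR : #R ≤ μ) (hJ : #J ≤ μ) (hD : ∀ j, #(D.obj j).A ≤ μ) : #c.pt.A ≤ μ := by
  have hs := (epi_iff _).1 (epi_freeLift_of_isColimit hc)
  refine (mk_le_of_surjective hs).trans (mk_formal_le hμ hμ' hR ?_)
  rw [mk_sigma]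
  exact (sum_le_sum _ (fun _ => μ) hD).trans (by
    rw [sum_const, lift_id, lift_id]
    exact mul_le_of_le hμ' hJ le_rfl)

end Cardinality

/-! ### Cellular factorizations of morphisms of contramodules. -/

section Factorization

open CellularFactorization

variable {R : Type u} [Ring R] [UniformSpace R] [IsUniformAddGroup R] [IsTopologicalRing R]
  [IsLinearTopology Rᵐᵒᵖ R] [CompleteSpace R] [T2Space R] [(𝓝 (0 : R)).IsCountablyGenerated]

/-- Any morphism of contramodules factors into a transfinite composition of pushouts of morphisms
from a given set, attached one by one, and a morphism with the right lifting property. -/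
theorem exists_cellular_factorization {ι : Type u} [Nonempty ι] {A B : ι → Contra R}
    (i : ∀ s, A s ⟶ B s) {X Z : Contra R} (f : X ⟶ Z) :
    ∃ (J : Type u) (_ : LinearOrder J) (_ : OrderBot J) (_ : OrderTop J) (_ : SuccOrder J)
      (_ : WellFoundedLT J) (D : J ⥤ Contra R) (e : D.obj ⊥ ≅ X) (p : D.obj ⊤ ⟶ Z),
      D.IsWellOrderContinuous ∧ D.map (homOfLE bot_le) ≫ p = e.hom ≫ f ∧
      (∀ j < ⊤, ∃ (s : ι) (a : A s ⟶ D.obj j) (b : B s ⟶ D.obj (Order.succ j)),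
        IsPushout a (i s) (D.map (homOfLE (Order.le_succ j))) b) ∧
      ∀ s, HasLiftingProperty (i s) p := by
  let ν : Cardinal.{u} := ℵ₀ + #R + #X.A + #Z.A + #ι + #(Σ s, (A s).A) + #(Σ s, (B s).A)
  have hν : ℵ₀ ≤ ν ∧ #R ≤ ν ∧ #X.A ≤ ν ∧ #Z.A ≤ ν ∧ #ι ≤ ν ∧ #(Σ s, (A s).A) ≤ ν ∧
      #(Σ s, (B s).A) ≤ ν := by
    refine ⟨?_, ?_, ?_, ?_, ?_, ?_, self_le_add_left _ _⟩
    · exact (((((self_le_add_right _ _).trans (self_le_add_right _ _)).trans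
        (self_le_add_right _ _)).trans (self_le_add_right _ _)).trans
        (self_le_add_right _ _)).trans (self_le_add_right _ _)
    · exact (((((self_le_add_left _ _).trans (self_le_add_right _ _)).trans
        (self_le_add_right _ _)).trans (self_le_add_right _ _)).trans
        (self_le_add_right _ _)).trans (self_le_add_right _ _)
    · exact ((((self_le_add_left _ _).trans (self_le_add_right _ _)).trans
        (self_le_add_right _ _)).trans (self_le_add_right _ _)).trans (self_le_add_right _ _)
    · exact (((self_le_add_left _ _).trans (self_le_add_right _ _)).trans
        (self_le_add_right _ _)).trans (self_le_add_right _ _)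
    · exact ((self_le_add_left _ _).trans (self_le_add_right _ _)).trans (self_le_add_right _ _)
    · exact (self_le_add_left _ _).trans (self_le_add_right _ _)
  obtain ⟨hν₀, hR, hX, hZ, hι, hA, hB⟩ := hν
  let μ : Cardinal.{u} := 2 ^ ν
  have hνμ : ν ≤ μ := (cantor ν).le
  have hμ : μ ^ ν = μ := by rw [← power_mul, mul_eq_self hν₀]
  have hμ₀ : ℵ₀ ≤ μ := hν₀.trans hνμ
  have hμne : μ ≠ 0 := (aleph0_pos.trans_le hμ₀).ne'
  have hμω : μ ^ ℵ₀ = μ := le_antisymm ((power_le_power_left hμne hν₀).trans hμ.le)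
    (self_le_power _ one_le_aleph0)
  have hA' : ∀ s, #(A s).A ≤ ν := fun s =>
    (mk_le_of_injective (f := Sigma.mk s) sigma_mk_injective).trans hA
  have hB' : ∀ s, #(B s).A ≤ ν := fun s =>
    (mk_le_of_injective (f := Sigma.mk s) sigma_mk_injective).trans hB
  have hκ : (Order.succ μ).IsRegular := isRegular_succ hμ₀
  obtain ⟨J, _, _, _, _, _, hJ⟩ := exists_isLong hκ
  have : Nonempty (Set.Iio (⊤ : J)) := hJ.isSuccLimit_top.nonempty_Iio.to_subtype
  let Q : ObjectProperty (Contra R) := fun Y => #Y.A ≤ μ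
  have : Q.IsClosedUnderIsomorphisms :=
    ⟨fun e h => (mk_congr ((monad R).forget.mapIso e).toEquiv).symm.le.trans h⟩
  refine ⟨J, inferInstance, inferInstance, inferInstance, inferInstance, inferInstance,
    exists_factorization hJ hκ (fun Y => ?_) (Q := Q) ?_ ?_ ?_ ?_ (hX.trans hνμ) f⟩
  · obtain ⟨s⟩ := ‹Nonempty ι›
    exact ⟨⟨s, 0, 0, by simp⟩⟩
  · intro s X Y a f b h hX
    exact mk_pushout_le h hμ₀ hX ((hB' s).trans hνμ)
  · intro j hj E c hc hE
    exact mk_colimit_le hc hμω hμ₀ (hR.trans hνμ) (Order.lt_succ_iff.1 (hJ.card_lt j hj)) hE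
  · intro Y hY
    rw [Order.lt_succ_iff]
    have hinj : Function.Injective fun p : Problem i Y =>
        (⟨p.idx, p.top, p.bot⟩ : Σ s, (A s ⟶ Y.left) × (B s ⟶ Z)) := by
      rintro ⟨s, a, b, h⟩ ⟨s', a', b', h'⟩ e
      obtain ⟨rfl, e⟩ := Sigma.mk.inj e
      obtain ⟨rfl, rfl⟩ := Prod.mk.inj (eq_of_heq e)
      rfl
    refine (mk_le_of_injective hinj).trans ?_
    rw [mk_sigma]
    refine (sum_le_sum _ (fun _ => μ) fun s => ?_).trans ?_
    · rw [mk_prod, lift_id, lift_id]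
      exact mul_le_of_le hμ₀ (mk_hom_le hμ hμne (hA' s) hY)
        (mk_hom_le hμ hμne (hB' s) (hZ.trans hνμ))
    · rw [sum_const, lift_id, lift_id]
      exact mul_le_of_le hμ₀ (hι.trans hνμ) le_rfl
  · intro E c hc s g
    have hAμ := (hA' s).trans hνμ
    exact exists_factorization_of_isColimit (Order.lt_succ_iff.2 hμ₀)
      (fun T t hT => hJ.exists_bound T t hT) (A s) (Order.lt_succ_iff.2 hAμ)
      (Order.lt_succ_iff.2 (mk_formal_le hμω hμ₀ (hR.trans hνμ) hAμ)) hc g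

end Factorization

end Contramodule

/-! ### `Ext¹` and lifting properties in abelian categories. -/

namespace Cotorsion

variable {K : Type u} [Category.{v} K] [Abelian K]

/-- The cokernel of a monomorphism is preserved by pushouts. -/
theorem exists_shortExact_of_isPushout {X₁ X₂ X₃ X₄ M : K} {t : X₁ ⟶ X₂} {l : X₁ ⟶ X₃}
    {r : X₂ ⟶ X₄} {b : X₃ ⟶ X₄} (h : IsPushout t l r b) {q : X₃ ⟶ M} {w : l ≫ q = 0}
    (hS : (ShortComplex.mk l q w).ShortExact) :
    ∃ (q' : X₄ ⟶ M) (w' : r ≫ q' = 0), b ≫ q' = q ∧ (ShortComplex.mk r q' w').ShortExact := by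
  have : Mono l := hS.mono_f
  have : Epi q := hS.epi_g
  have hr : Mono r := MorphismProperty.of_isPushout (P := .monomorphisms K) h ‹Mono l›
  have hq : b ≫ h.desc 0 q (by rw [comp_zero, w]) = q := h.inr_desc _ _ _
  have : Epi (h.desc 0 q (by rw [comp_zero, w])) := by
    have : Epi (b ≫ h.desc 0 q (by rw [comp_zero, w])) := by rwa [hq]
    exact epi_of_epi b _
  refine ⟨h.desc 0 q (by rw [comp_zero, w]), h.inl_desc _ _ _, hq, ?_⟩
  refine { exact := ShortComplex.exact_of_g_is_cokernel _ ?_, mono_f := hr, epi_g := this }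
  refine CokernelCofork.IsColimit.ofπ' _ _ fun {T} k hk => ?_
  have hk' : l ≫ b ≫ k = 0 := by rw [← Category.assoc, ← h.w, Category.assoc, hk, comp_zero]
  refine ⟨hS.exact.desc (b ≫ k) hk', h.hom_ext ?_ ?_⟩
  · rw [← Category.assoc, h.inl_desc, zero_comp, hk]
  · rw [← Category.assoc, h.inr_desc]
    exact hS.exact.g_desc _ _

/-- The cokernel of a morphism is its pushout along the morphism to zero. -/
theorem isPushout_cokernel {X Y O : K} (hO : IsZero O) (f : X ⟶ Y) :
    IsPushout (0 : X ⟶ O) f (0 : O ⟶ cokernel f) (cokernel.π f) where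
  w := by rw [comp_zero, cokernel.condition]
  isColimit' := ⟨PushoutCocone.IsColimit.mk _
    (fun s => cokernel.desc f s.inr (by rw [← s.condition, zero_comp]))
    (fun s => hO.eq_of_src _ _) (fun s => cokernel.π_desc _ _ _)
    fun s m _ hm => by rw [← cancel_epi (cokernel.π f), hm, cokernel.π_desc]⟩

/-- The epimorphisms with kernel `Y`. -/
def episWithKernel (Y : K) : MorphismProperty K := fun E _ p =>
  ∃ (j : Y ⟶ E) (w : j ≫ p = 0), (ShortComplex.mk j p w).ShortExact

theorem episWithKernel_kernel {E X : K} (p : E ⟶ X) [Epi p] : episWithKernel (kernel p) p :=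
  ⟨kernel.ι p, kernel.condition p,
    { exact := ShortComplex.exact_of_f_is_kernel _ (kernelIsKernel p) }⟩

/-- Lifting against `Y ⟶ 0` is the extension of morphisms to `Y`; this case is used for
preenvelopes. -/
theorem episWithKernel_of_isZero {Y Z : K} (hZ : IsZero Z) (p : Y ⟶ Z) :
    episWithKernel Y p := by
  obtain rfl := hZ.eq_zero_of_tgt p
  have : Epi (0 : Y ⟶ Z) := hZ.epi _
  exact ⟨𝟙 Y, comp_zero, { exact := (ShortComplex.exact_iff_epi _ rfl).2 inferInstance }⟩

variable [HasExt.{w} K]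

open Abelian

/-- Vanishing of `Ext¹` allows one to extend morphisms along a monomorphism. -/
theorem exists_extension {S : ShortComplex K} (hS : S.ShortExact) {Y : K}
    (h : Subsingleton (Ext.{w} S.X₃ Y 1)) (g : S.X₁ ⟶ Y) : ∃ k : S.X₂ ⟶ Y, S.f ≫ k = g := by
  obtain ⟨x, hx⟩ := Ext.contravariant_sequence_exact₁ hS Y (Ext.mk₀ g) (add_zero 1)
    (Subsingleton.elim _ _)
  obtain ⟨k, rfl⟩ := (Ext.mk₀_bijective _ _).2 x
  refine ⟨k, (Ext.mk₀_bijective _ _).1 ?_⟩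
  rw [← hx, Ext.mk₀_comp_mk₀]

/-- The extension property for a projective presentation implies vanishing of `Ext¹`. -/
theorem subsingleton_ext_of_extension {S : ShortComplex K} (hS : S.ShortExact)
    [Projective S.X₂] {Y : K} (h : ∀ g : S.X₁ ⟶ Y, ∃ k : S.X₂ ⟶ Y, S.f ≫ k = g) :
    Subsingleton (Ext.{w} S.X₃ Y 1) := by
  refine subsingleton_of_forall_eq 0 fun x => ?_
  obtain ⟨y, rfl⟩ := Ext.contravariant_sequence_exact₃ hS Y x (Ext.eq_zero_of_projective _)
    (add_zero 1)
  obtain ⟨g, rfl⟩ := (Ext.mk₀_bijective _ _).2 y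
  obtain ⟨k, rfl⟩ := h g
  rw [← Ext.mk₀_comp_mk₀, hS.extClass_comp_assoc]

/-- A monomorphism whose cokernel is orthogonal to `Y` lifts against epimorphisms
with kernel `Y`. -/
theorem llp_of_subsingleton_ext {S : ShortComplex K} (hS : S.ShortExact) {Y : K}
    (h : Subsingleton (Ext.{w} S.X₃ Y 1)) : (episWithKernel Y).llp S.f := by
  rintro E X p ⟨j, w, hp⟩
  refine ⟨fun {a b} sq => ?_⟩
  -- The obstruction to lifting `b` through `p` vanishes on `S.X₁`, where `a` is a lift, so it comes
  -- from `Ext¹(S.X₃, Y) = 0`.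
  have hb : (Ext.mk₀ b).comp hp.extClass (zero_add 1) = 0 := by
    obtain ⟨x, hx⟩ := Ext.contravariant_sequence_exact₂ hS Y
      ((Ext.mk₀ b).comp hp.extClass (zero_add 1)) (by
        rw [Ext.mk₀_comp_mk₀_assoc, ← sq.w, ← Ext.mk₀_comp_mk₀_assoc]
        have := hp.comp_extClass
        dsimp only at this
        rw [this, Ext.comp_zero])
    rw [← hx, Subsingleton.elim x 0, Ext.comp_zero]
  obtain ⟨y, hy⟩ := Ext.covariant_sequence_exact₃ _ hp (Ext.mk₀ b) (zero_add 1) hb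
  obtain ⟨k, rfl⟩ := (Ext.mk₀_bijective _ _).2 y
  have hk : k ≫ p = b := (Ext.mk₀_bijective _ _).1 (by rw [← hy, Ext.mk₀_comp_mk₀])
  have : Mono j := hp.mono_f
  -- The lift `k` of `b` need not restrict to `a`; the discrepancy lands in `Y` and extends to
  -- `S.X₂`, which gives the correction.
  have hd : (a - S.f ≫ k) ≫ p = 0 := by
    rw [Preadditive.sub_comp, Category.assoc, hk, sq.w, sub_self]
  obtain ⟨g, hg⟩ := exists_extension hS h (hp.exact.lift (a - S.f ≫ k) hd)
  have hl : hp.exact.lift (a - S.f ≫ k) hd ≫ j = a - S.f ≫ k := hp.exact.lift_f _ _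
  refine ⟨⟨⟨k + g ≫ j, ?_, ?_⟩⟩⟩
  · rw [Preadditive.comp_add, ← Category.assoc S.f g j, hg, hl, add_sub_cancel]
  · rw [Preadditive.add_comp, hk, Category.assoc, w, comp_zero, add_zero]

/-- An object that lifts against all epimorphisms with kernel `Y` is orthogonal to `Y`. -/
theorem subsingleton_ext_of_llp [EnoughProjectives K] {O X Y : K} (hO : IsZero O) (f : O ⟶ X)
    (h : (episWithKernel Y).llp f) : Subsingleton (Ext.{w} X Y 1) := by
  have hS : (ShortComplex.mk (kernel.ι (Projective.π X)) (Projective.π X)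
      (kernel.condition _)).ShortExact :=
    { exact := ShortComplex.exact_of_f_is_kernel _ (kernelIsKernel _) }
  refine subsingleton_ext_of_extension hS fun g => ?_
  -- Pushing the projective presentation out along `g` gives an extension of `X` by `Y`. Lifting `0
  -- → X` against its projection splits it, and subtracting the section from the map of the
  -- projective cover leaves an extension of `g`.
  obtain ⟨q, w, hq, hE⟩ := exists_shortExact_of_isPushout
    (IsPushout.of_hasPushout g (kernel.ι (Projective.π X))) hS
  have := h q ⟨_, w, hE⟩
  have sq : CommSq (hO.to_ _) f q (𝟙 X) := ⟨hO.eq_of_src _ _⟩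
  have hs : sq.lift ≫ q = 𝟙 X := sq.fac_right
  have hd : (pushout.inr g (kernel.ι (Projective.π X)) - Projective.π X ≫ sq.lift) ≫ q = 0 := by
    rw [Preadditive.sub_comp, hq, Category.assoc, hs, Category.comp_id, sub_self]
  have : Mono (pushout.inl g (kernel.ι (Projective.π X))) := hE.mono_f
  have hl : hE.exact.lift _ hd ≫ pushout.inl g (kernel.ι (Projective.π X)) = _ :=
    hE.exact.lift_f _ _
  refine ⟨hE.exact.lift _ hd, ?_⟩
  rw [← cancel_mono (pushout.inl g (kernel.ι (Projective.π X))), Category.assoc]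
  rw [hl, Preadditive.comp_sub, ← Category.assoc, kernel.condition, zero_comp, sub_zero,
    pushout.condition]

theorem subsingleton_ext_of_retract {X Z Y : K} (a : X ⟶ Z) (b : Z ⟶ X) (hab : a ≫ b = 𝟙 X)
    (h : Subsingleton (Ext.{w} Z Y 1)) : Subsingleton (Ext.{w} X Y 1) := by
  refine subsingleton_of_forall_eq 0 fun x => ?_
  rw [← Ext.mk₀_id_comp x, ← hab, ← Ext.mk₀_comp_mk₀_assoc,
    Subsingleton.elim ((Ext.mk₀ b).comp x (zero_add 1)) 0, Ext.comp_zero]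

section Chains

variable {J : Type v} [LinearOrder J] [OrderBot J] [OrderTop J] [SuccOrder J] [WellFoundedLT J]
  {D : J ⥤ K}

-- As `⊤` is terminal in `J`, the object `D ⊤` is the colimit of `D`, so the map is a transfinite
-- composition of the successor steps.
omit [Abelian K] [HasExt.{w} K] in
theorem llp_map_bot_top [D.IsWellOrderContinuous] {W : MorphismProperty K}
    (h : ∀ j < ⊤, W.llp (D.map (homOfLE (Order.le_succ j)))) :
    W.llp (D.map (homOfLE (bot_le : (⊥ : J) ≤ ⊤))) := by
  let t : W.llp.TransfiniteCompositionOfShape J (D.map (homOfLE (bot_le : (⊥ : J) ≤ ⊤))) :=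
    { F := D
      isoBot := Iso.refl _
      incl :=
        { app j := D.map (homOfLE le_top)
          naturality j k φ := by
            rw [← D.map_comp]
            exact (Category.comp_id _).symm }
      isColimit := colimitOfDiagramTerminal isTerminalTop D
      fac := Category.id_comp _
      map_mem j hj := h j (lt_top_iff_ne_top.2 fun e => hj (e ▸ isMax_top)) }
  exact W.llp.transfiniteCompositionsOfShape_le J _ t.mem

end Chains

/-- Eklof's lemma. -/
theorem subsingleton_ext_of_filt [EnoughProjectives K] {T : ObjectProperty K} {X Y : K}
    (hX : Filt T X) (h : ∀ Z, T Z → Subsingleton (Ext.{w} Z Y 1)) :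
    Subsingleton (Ext.{w} X Y 1) := by
  obtain ⟨J, _, _, _, _, _, D, _, h₀, ⟨e⟩, hD⟩ := hX
  refine subsingleton_ext_of_retract e.inv e.hom e.inv_hom_id
    (subsingleton_ext_of_llp h₀ _ (llp_map_bot_top fun j hj => ?_))
  obtain ⟨_, Z, hZ, ⟨e'⟩⟩ := hD j hj.ne
  have hS : (ShortComplex.mk (D.map (homOfLE (Order.le_succ j))) (cokernel.π _)
      (cokernel.condition _)).ShortExact :=
    { exact := ShortComplex.exact_of_g_is_cokernel _ (cokernelIsCokernel _) }
  exact llp_of_subsingleton_ext hS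
    (subsingleton_ext_of_retract e'.hom e'.inv e'.hom_inv_id (h Z hZ))

/-- The kernel of a morphism with the right lifting property is orthogonal to the object with the
given projective presentation. -/
theorem subsingleton_ext_of_rlp {S : ShortComplex K} (hS : S.ShortExact) [Projective S.X₂]
    {E Z Y : K} {p : E ⟶ Z} (hp : episWithKernel Y p) [HasLiftingProperty S.f p] :
    Subsingleton (Ext.{w} S.X₃ Y 1) := by
  obtain ⟨j, w, hp⟩ := hp
  refine subsingleton_ext_of_extension hS fun g => ?_
  -- With zero as the bottom side, a lift has values in the kernel `Y` and so extends `g`.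
  have sq : CommSq (g ≫ j) S.f p 0 := ⟨by rw [Category.assoc, w, comp_zero, comp_zero]⟩
  have hl : sq.lift ≫ p = 0 := sq.fac_right
  have : Mono j := hp.mono_f
  have hj : hp.exact.lift sq.lift hl ≫ j = sq.lift := hp.exact.lift_f _ _
  refine ⟨hp.exact.lift sq.lift hl, ?_⟩
  rw [← cancel_mono j, Category.assoc]
  rw [hj, sq.fac_left]

/-- An epimorphism from `E` onto an object orthogonal to the kernel is a split epimorphism. -/
theorem exists_biprod_iso {E X : K} (p : E ⟶ X) [Epi p]
    (h : Subsingleton (Ext.{w} X (kernel p) 1)) : Nonempty (X ⊞ kernel p ≅ E) := by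
  have hS : (ShortComplex.mk (kernel.ι p) p (kernel.condition p)).ShortExact :=
    { exact := ShortComplex.exact_of_f_is_kernel _ (kernelIsKernel p) }
  obtain ⟨r, hr⟩ := exists_extension hS h (𝟙 (kernel p))
  let s := ShortComplex.Splitting.ofExactOfRetraction _ hS.exact r hr hS.epi_g
  exact ⟨biprod.braiding _ _ ≪≫ s.isoBinaryBiproduct.symm⟩

end Cotorsion

namespace Contramodule

open Cotorsion Abelian

open scoped ZeroObject

/-! ### Free contramodules are projective and suffice to cover. -/

section Projectives

variable {R : Type u} [Ring R] [UniformSpace R] [IsUniformAddGroup R] [IsTopologicalRing R]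
  [IsLinearTopology Rᵐᵒᵖ R] [CompleteSpace R] [T2Space R]

instance (X : Type u) : Projective (freeContra R X) where
  factors {E P} f e he := by
    have hs := (epi_iff e).1 he
    refine ⟨freeLift fun x => Function.surjInv hs (f.f (gen x)), freeHom_ext fun x => ?_⟩
    rw [comp_apply, freeLift_gen]
    exact Function.surjInv_eq hs _

/-- The canonical epimorphism from a free contramodule. -/
def freeCover (P : Contra R) : freeContra R P.A ⟶ P := freeLift id

instance (P : Contra R) : Epi (freeCover P) :=
  epi_of_surjective fun p => ⟨gen p, freeLift_gen _ _⟩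

instance : EnoughProjectives (Contra R) :=
  ⟨fun P => ⟨{ p := freeContra R P.A, f := freeCover P }⟩⟩

/-- Right lifting property against the inclusion of zero in the free contramodule with one
generator means surjectivity. -/
theorem epi_of_hasLiftingProperty {O E P : Contra R} {i : O ⟶ freeContra R PUnit.{u + 1}}
    (hi : i = 0) {f : E ⟶ P} (hf : HasLiftingProperty i f) : Epi f := by
  refine epi_of_surjective fun y => ?_
  have sq : CommSq 0 i f (freeLift fun _ : PUnit => y) := ⟨by rw [hi, zero_comp, zero_comp]⟩
  refine ⟨sq.lift.f (gen PUnit.unit), ?_⟩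
  rw [← comp_apply, sq.fac_right, freeLift_gen]

end Projectives

/-! ### Special precovers and preenvelopes. -/

section Main

variable {R : Type u} [Ring R] [UniformSpace R] [IsUniformAddGroup R] [IsTopologicalRing R]
  [IsLinearTopology Rᵐᵒᵖ R] [CompleteSpace R] [T2Space R]
  (S : ObjectProperty (Contra R)) [ObjectProperty.Small.{u} S]

/-- The indices of the cells: the objects of `S`, and one more for the ring. -/
abbrev CellIndex : Type u := Option (Shrink.{u} (Subtype S))

/-- The cokernels of the cells: the objects of `S` and the free contramodule with one generator. -/
def cellQuotient : CellIndex S → Contra R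
  | none => freeContra R PUnit.{u + 1}
  | some s => ((equivShrink (Subtype S)).symm s).1

/-- The projective objects covering the cokernels of the cells. -/
def cellCover : CellIndex S → Contra R
  | none => freeContra R PUnit.{u + 1}
  | some s => freeContra R ((equivShrink (Subtype S)).symm s).1.A

/-- The projections from `cellCover` to `cellQuotient`. -/
def cellProj : ∀ s, cellCover S s ⟶ cellQuotient S s
  | none => 𝟙 _
  | some s => freeCover ((equivShrink (Subtype S)).symm s).1

/-- The generating cells. -/
def cell (s : CellIndex S) : kernel (cellProj S s) ⟶ cellCover S s := kernel.ι (cellProj S s)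

instance (s : CellIndex S) : Projective (cellCover S s) := by
  cases s <;> exact inferInstanceAs (Projective (freeContra R _))

theorem cell_shortExact (s : CellIndex S) :
    (ShortComplex.mk (cell S s) (cellProj S s) (kernel.condition _)).ShortExact :=
  { exact := ShortComplex.exact_of_f_is_kernel _ (kernelIsKernel _)
    mono_f := inferInstanceAs (Mono (kernel.ι _))
    epi_g := by
      cases s
      · exact inferInstanceAs (Epi (𝟙 (freeContra R PUnit.{u + 1})))
      · exact inferInstanceAs (Epi (freeCover _)) }

/-- The cell of the ring is the kernel of an identity, that is, `0 → R`; lifting against it makes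
the precovers epimorphisms. -/
theorem cell_none : cell S none = 0 :=
  (Category.comp_id _).symm.trans (kernel.condition (cellProj S none))

theorem cellQuotient_mem (s : CellIndex S) :
    (S ⊔ ObjectProperty.singleton (freeContra R PUnit.{u + 1})) (cellQuotient S s) := by
  cases s with
  | none => exact Or.inr ((ObjectProperty.singleton_iff _ _).2 rfl)
  | some s => exact Or.inl ((equivShrink (Subtype S)).symm s).2

theorem exists_cellQuotient_eq {X : Contra R} (hX : S X) : ∃ s, cellQuotient S s = X :=
  ⟨some (equivShrink _ ⟨X, hX⟩), by simp [cellQuotient]⟩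

omit [ObjectProperty.Small.{u} S] in
/-- Objects of `S^⊥` are also right orthogonal to the free contramodule with one generator. -/
theorem subsingleton_ext_of_rightPerp {Y : Contra R} (hY : rightPerp S Y) {X : Contra R}
    (hX : (S ⊔ ObjectProperty.singleton (freeContra R PUnit.{u + 1})) X) :
    Subsingleton (Ext X Y 1) := by
  rcases hX with hX | hX
  · exact hY X hX
  · obtain rfl := (ObjectProperty.singleton_iff _ _).1 hX
    exact Ext.subsingleton_of_projective _ _ 0

theorem rightPerp_of_rlp {E Z Y : Contra R} {p : E ⟶ Z} (hp : episWithKernel Y p)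
    (h : ∀ s, HasLiftingProperty (cell S s) p) : rightPerp S Y := fun X hX => by
  obtain ⟨s, rfl⟩ := exists_cellQuotient_eq S hX
  have := h s
  exact subsingleton_ext_of_rlp (cell_shortExact S s) hp

variable [(𝓝 (0 : R)).IsCountablyGenerated]

/-- Special precovers by objects filtered by `S` and the free contramodule with one generator. -/
theorem exists_filt_precover (P : Contra R) :
    ∃ (E : Contra R) (p : E ⟶ P),
      Filt (S ⊔ ObjectProperty.singleton (freeContra R PUnit.{u + 1})) E ∧
        Epi p ∧ rightPerp S (kernel p) := by
  obtain ⟨J, _, _, _, _, _, D, e, p, hD, -, hp, hlift⟩ :=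
    exists_cellular_factorization (cell S) (0 : (0 : Contra R) ⟶ P)
  have hepi : Epi p := epi_of_hasLiftingProperty (cell_none S) (hlift none)
  refine ⟨D.obj ⊤, p, ?_, hepi, rightPerp_of_rlp S (episWithKernel_kernel p) hlift⟩
  refine ⟨J, inferInstance, inferInstance, inferInstance, inferInstance, inferInstance, D, hD,
     (isZero_zero _).of_iso e, ⟨Iso.refl _⟩,
    fun j hj => ?_⟩
  obtain ⟨s, a, b, h⟩ := hp j (lt_top_iff_ne_top.2 hj)
  -- A pushout of a cell is a monomorphism with the same cokernel as the cell.
  obtain ⟨q, w, -, hS⟩ := exists_shortExact_of_isPushout h (cell_shortExact S s)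
  exact ⟨hS.mono_f, _, cellQuotient_mem S s,
    ⟨(cokernelIsCokernel _).coconePointUniqueUpToIso hS.gIsCokernel⟩⟩

/-- Subobjects of objects of `S^⊥` have special preenvelopes. -/
theorem exists_preenvelope {P B : Contra R} (i : P ⟶ B) [Mono i] (hB : rightPerp S B) :
    ∃ (E : Contra R) (f : P ⟶ E), rightPerp S E ∧ Mono f ∧
      leftPerp (rightPerp S) (cokernel f) := by
  obtain ⟨J, _, _, _, _, _, D, e, p, hD, -, hp, hlift⟩ :=
    exists_cellular_factorization (cell S) (0 : P ⟶ 0)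
  have hllp : ∀ Y, rightPerp S Y →
      (episWithKernel Y).llp (e.inv ≫ D.map (homOfLE (bot_le : (⊥ : J) ≤ ⊤))) := by
    intro Y hY
    refine ((episWithKernel Y).llp.cancel_left_of_respectsIso _ _).2
      (llp_map_bot_top fun j hj => ?_)
    obtain ⟨s, a, b, h⟩ := hp j hj
    exact MorphismProperty.of_isPushout (P := (episWithKernel Y).llp) h
      (llp_of_subsingleton_ext (cell_shortExact S s)
        (subsingleton_ext_of_rightPerp S hY (cellQuotient_mem S s)))
  let f : P ⟶ D.obj ⊤ := e.inv ≫ D.map (homOfLE (bot_le : (⊥ : J) ≤ ⊤))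
  -- Since `B` is in `S^⊥`, the map `f` lifts against `B ⟶ 0`, so the embedding `i` factors through
  -- `f`.
  have hmono : Mono f := by
    have := hllp B hB (0 : B ⟶ 0) (episWithKernel_of_isZero (isZero_zero _) _)
    have sq : CommSq i f (0 : B ⟶ 0) 0 := ⟨by simp⟩
    have : Mono (f ≫ sq.lift) := by rwa [sq.fac_left]
    exact mono_of_mono f sq.lift
  refine ⟨D.obj ⊤, f, rightPerp_of_rlp S (episWithKernel_of_isZero (isZero_zero _) p) hlift,
    hmono, fun Y hY => ?_⟩
  -- The map `0 → cokernel f` is a pushout of `f` and inherits its left lifting property.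
  exact subsingleton_ext_of_llp (isZero_zero _) _
    (MorphismProperty.of_isPushout (P := (episWithKernel Y).llp)
      (isPushout_cokernel (isZero_zero _) f) (hllp Y hY))

end Main

end Contramodule
end

/-- Let `R` be a complete, separated, associative and unital topological ring with a countable base
of neighborhoods of zero formed by open right ideals, and let `(F, C)` be the cotorsion theory
generated by a set `S` of left `R`-contramodules. Every contramodule has a special `F`-precover;
every subcontramodule of a contramodule from `C` has a special `C`-preenvelope; and `F` consists of
the direct summands of contramodules from `Filt(S ∪ {R})`. -/
theorem mainTheorem12 (R : Type u) [Ring R] [UniformSpace R] [IsUniformAddGroup R]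
    [IsTopologicalRing R] [IsLinearTopology Rᵐᵒᵖ R] [CompleteSpace R] [T2Space R]
    [(𝓝 (0 : R)).IsCountablyGenerated]
    (S F C : ObjectProperty (Contramodule.Contra R)) [ObjectProperty.Small.{u} S]
    (hFC : Cotorsion.IsGeneratedBy F C S) :
    (∀ P : Contramodule.Contra R, Cotorsion.HasSpecialPrecover F C P) ∧
    (∀ P : Contramodule.Contra R,
      (∃ (B : Contramodule.Contra R) (i : P ⟶ B), C B ∧ Mono i) →
        Cotorsion.HasSpecialPreenvelope F C P) ∧
    (∀ P : Contramodule.Contra R,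
      F P ↔ Cotorsion.IsSummandOf
        (Cotorsion.Filt
          (S ⊔ ObjectProperty.singleton (Contramodule.freeContra R PUnit.{u + 1}))) P) := by
  obtain ⟨⟨-, rfl⟩, rfl⟩ := hFC
  refine ⟨fun P => ?_, fun P hP => ?_, fun P => ⟨fun hP => ?_, fun hP Y hY => ?_⟩⟩
  · obtain ⟨E, p, hE, hp, hk⟩ := Contramodule.exists_filt_precover S P
    exact ⟨E, p, fun Y hY => Cotorsion.subsingleton_ext_of_filt hE fun X hX =>
      Contramodule.subsingleton_ext_of_rightPerp S hY hX, hp, hk⟩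
  · obtain ⟨B, i, hB, hi⟩ := hP
    exact Contramodule.exists_preenvelope S i hB
  · obtain ⟨E, p, hE, hp, hk⟩ := Contramodule.exists_filt_precover S P
    -- The kernel lies in `C` and `P` in `F`, so the precover splits.
    exact ⟨kernel p, E, hE, Cotorsion.exists_biprod_iso p (hP _ hk)⟩
  · obtain ⟨X', Z, hZ, ⟨e⟩⟩ := hP
    exact Cotorsion.subsingleton_ext_of_retract (biprod.inl ≫ e.hom) (e.inv ≫ biprod.fst) (by simp)
      (Cotorsion.subsingleton_ext_of_filt hZ fun X hX =>
        Contramodule.subsingleton_ext_of_rightPerp S hY hX)
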